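/- Let $\alpha\in(0,1)$ and $\beta>0$. There is a constant $c=c_{\alpha,\beta}>0$, depending only on $\alpha$ and $\beta$, such that the following holds. Let $n\ge 3$ and let $A(x)=(a_{ij}(x))$ be a measurable real symmetric matrix on $\mathbb R^n$ with $\lambda|\xi|^2\le\sum_{i,j}a_{ij}(x)\xi_i\xi_j\le\lambda^{-1}|\xi|^2$ for all $x,\xi\in\mathbb R^n$ and some $\lambda\in(0,1]$, whose entries are $C^1$ and satisfy, for some $\theta\in(0,1]$ and $K>0$, $|a_{ij}|\le K$, $|\nabla a_{ij}|\le K$ and $|a_{ij}(x)-a_{ij}(y)|\le K|x-y|^{\theta}$. Let $V\ge 0$, not almost everywhere zero, belong to the reverse Hölder class $B_q$ for some $q>n/2$; that is, $V\in L^q_{\rm loc}(\mathbb R^n)$ and for some $C>0$ one has $\bigl(\frac1{|B|}\int_B V^q\,dx\bigr)^{1/q}\le \frac{C}{|B|}\int_B V\,dx$ for every ball $B\subset\mathbb R^n$. Let $L=-\operatorname{div}(A\nabla)+V$ be the nonnegative self-adjoint operator on the complex space $L^2(\mathbb R^n)$ associated with the form $$a(u,v)=\int\sum_{i,j}a_{ij}\,\partial_ju\,\overline{\partial_iv}\,dx+\int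 Vu\overline v\,dx$$ with domain $\{u\in L^2:\nabla u\in L^2,\ V^{1/2}u\in L^2\}$ ($\nabla$ the weak gradient), and let $L^\beta$ and $e^{-tL^\alpha}$ be given by the functional calculus of $L$. Then for every $t>0$ the operator $D_t=t^{\beta/\alpha}L^{\beta}e^{-tL^{\alpha}}$ is defined on all of $L^2(\mathbb R^n)$, and: 1. $f\mapsto \sqrt c\,D_tf(x)$ is a linear isometry from $L^2(\mathbb R^n)$ into $L^2(\mathbb R^{n+1}_+,\,dx\,dt/t)$, where $\mathbb R^{n+1}_+=\mathbb R^n\times(0,\infty)$. 2. For every $f\in L^2(\mathbb R^n)$ the $L^2(\mathbb R^n)$-valued integrals $\int_\epsilon^N D_t^2f\,\frac{dt}{t}$, $0<\epsilon\le N<\infty$, exist, and $$f=c\lim_{N\to\infty}\lim_{\epsilon\to0^+}\int_\epsilon^N D_t^2f\,\frac{dt}{t}\quad\text{in }L^2(\mathbb R^n),$$ where the inner limit exists in $L^2(\mathbb R^n)$ for every $N>0$; the formula also holds when $\epsilon\to0^+$ and $N\to\infty$ jointly and independently. -/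

import Mathlib

open MeasureTheory Set Filter Topology
open scoped ComplexConjugate ContDiff

noncomputable section

/-- The Euclidean space `ℝⁿ`. -/
abbrev Rn (n : ℕ) : Type := EuclideanSpace ℝ (Fin n)

/-- The complex Hilbert space `L²(ℝⁿ)`. -/
abbrev L2 (n : ℕ) : Type := Lp ℂ 2 (volume : Measure (Rn n))

/-! ### Coefficients and potentials -/

/-- `A` is a measurable, real symmetric, uniformly elliptic and bounded matrix. -/
structure IsElliptic {n : ℕ} (A : Rn n → Matrix (Fin n) (Fin n) ℝ) : Prop where
  measurable : ∀ i j, Measurable fun x => A x i j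
  symm : ∀ x i j, A x i j = A x j i
  elliptic : ∃ lam : ℝ, 0 < lam ∧ lam ≤ 1 ∧ ∀ x ξ : Rn n,
    lam * ‖ξ‖ ^ 2 ≤ ∑ i, ∑ j, A x i j * ξ i * ξ j ∧
      ∑ i, ∑ j, A x i j * ξ i * ξ j ≤ lam⁻¹ * ‖ξ‖ ^ 2

/-- Regularity of the coefficients: for some `θ ∈ (0, 1]` and `K > 0` the entries of `A` are continuously
differentiable, and the suprema of `|a_ij|`, of `|∇ a_ij|` and of
`|a_ij x - a_ij y| / |x - y| ^ θ` are at most `K`. -/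
def HasHolderCoeff {n : ℕ} (A : Rn n → Matrix (Fin n) (Fin n) ℝ) : Prop :=
  ∃ θ K : ℝ, 0 < θ ∧ θ ≤ 1 ∧ 0 < K ∧ ∀ i j,
    ContDiff ℝ 1 (fun x => A x i j) ∧ (∀ x, |A x i j| ≤ K) ∧
      (∀ x, ‖fderiv ℝ (fun y => A y i j) x‖ ≤ K) ∧
      ∀ x y, |A x i j - A y i j| ≤ K * ‖x - y‖ ^ θ

/-- The reverse Hölder class `B_q`. -/
structure IsReverseHolder {n : ℕ} (q : ℝ) (V : Rn n → ℝ) : Prop where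
  nonneg : ∀ x, 0 ≤ V x
  locallyLq : ∀ K : Set (Rn n), IsCompact K → MemLp V (ENNReal.ofReal q) (volume.restrict K)
  reverse : ∃ C : ℝ, 0 < C ∧ ∀ (x : Rn n) (r : ℝ), 0 < r →
    (⨍ y in Metric.ball x r, V y ^ q) ^ (1 / q) ≤ C * ⨍ y in Metric.ball x r, V y

/-! ### The operator `L = -div (A ∇) + V` -/

/-- `g` is the weak partial derivative `∂ᵢ u`. -/
def HasWeakDeriv {n : ℕ} (i : Fin n) (u g : L2 n) : Prop :=
  ∀ φ : Rn n → ℝ, ContDiff ℝ ∞ φ → HasCompactSupport φ →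
    ∫ x, (fderiv ℝ φ x (EuclideanSpace.single i 1)) • u x = - ∫ x, φ x • g x

/-- `u` belongs to the form domain `{u ∈ L² : ∇u ∈ L², V^{1/2} u ∈ L²}`, with weak gradient
`Du`. -/
def InFormDomain {n : ℕ} (V : Rn n → ℝ) (u : L2 n) (Du : Fin n → L2 n) : Prop :=
  (∀ i, HasWeakDeriv i u (Du i)) ∧ MemLp (fun x => ((√(V x) : ℝ) : ℂ) * u x) 2 volume

/-- The energy form `∫ ∑ᵢⱼ aᵢⱼ ∂ⱼu conj(∂ᵢv) + ∫ V u conj(v)`. -/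
def energyForm {n : ℕ} (A : Rn n → Matrix (Fin n) (Fin n) ℝ) (V : Rn n → ℝ)
    (u : L2 n) (Du : Fin n → L2 n) (v : L2 n) (Dv : Fin n → L2 n) : ℂ :=
  (∫ x, ∑ i, ∑ j, (A x i j : ℂ) * Du j x * conj (Dv i x)) + ∫ x, (V x : ℂ) * u x * conj (v x)

theorem HasWeakDeriv.integrable_aux {n : ℕ} (u : L2 n) {φ : Rn n → ℝ} (h : Continuous φ)
    (hc : HasCompactSupport φ) : Integrable (fun x => φ x • u x) := by
  have h1 : MemLp φ 2 (volume : Measure (Rn n)) := h.memLp_of_hasCompactSupport hc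
  exact memLp_one_iff_integrable.1 (MemLp.smul (p := 2) (q := 2) (r := 1) (Lp.memLp u) h1)

theorem fderiv_single_continuous {n : ℕ} (i : Fin n) {φ : Rn n → ℝ} (h : ContDiff ℝ ∞ φ) :
    Continuous fun x => fderiv ℝ φ x (EuclideanSpace.single i 1) :=
  (h.continuous_fderiv (by simp)).clm_apply continuous_const

theorem fderiv_single_compact {n : ℕ} (i : Fin n) {φ : Rn n → ℝ} (h : HasCompactSupport φ) :
    HasCompactSupport fun x => fderiv ℝ φ x (EuclideanSpace.single i 1) :=
  h.fderiv_apply (𝕜 := ℝ) _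

theorem HasWeakDeriv.add {n : ℕ} {i : Fin n} {u g u' g' : L2 n} (h : HasWeakDeriv i u g)
    (h' : HasWeakDeriv i u' g') : HasWeakDeriv i (u + u') (g + g') := by
  intro φ hφ hc
  have e1 : ∀ (ψ : Rn n → ℝ) (a b : L2 n),
      (fun x => ψ x • (a + b : L2 n) x) =ᵐ[volume] fun x => ψ x • a x + ψ x • b x := by
    intro ψ a b
    filter_upwards [Lp.coeFn_add a b] with x hx
    rw [hx, Pi.add_apply, smul_add]
  have i1 := fun a : L2 n => HasWeakDeriv.integrable_aux a (fderiv_single_continuous i hφ)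
    (fderiv_single_compact i hc)
  have i2 := fun a : L2 n => HasWeakDeriv.integrable_aux a hφ.continuous hc
  rw [integral_congr_ae (e1 _ u u'), integral_congr_ae (e1 φ g g'), integral_add (i1 u) (i1 u'),
    integral_add (i2 g) (i2 g'), h φ hφ hc, h' φ hφ hc]
  ring

theorem HasWeakDeriv.smul {n : ℕ} {i : Fin n} {u g : L2 n} (c : ℂ) (h : HasWeakDeriv i u g) :
    HasWeakDeriv i (c • u) (c • g) := by
  intro φ hφ hc
  have e1 : ∀ (ψ : Rn n → ℝ) (a : L2 n),
      (fun x => ψ x • (c • a : L2 n) x) =ᵐ[volume] fun x => c • (ψ x • a x) := by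
    intro ψ a
    filter_upwards [Lp.coeFn_smul c a] with x hx
    rw [hx, Pi.smul_apply, smul_comm]
  rw [integral_congr_ae (e1 _ u), integral_congr_ae (e1 φ g), integral_smul, integral_smul,
    h φ hφ hc, smul_neg]

theorem InFormDomain.add {n : ℕ} {V : Rn n → ℝ} {u u' : L2 n} {Du Du' : Fin n → L2 n}
    (h : InFormDomain V u Du) (h' : InFormDomain V u' Du') :
    InFormDomain V (u + u') (Du + Du') := by
  refine ⟨fun i => (h.1 i).add (h'.1 i), (h.2.add h'.2).ae_eq ?_⟩
  filter_upwards [Lp.coeFn_add u u'] with x hx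
  simp only [Pi.add_apply, hx, mul_add]

theorem InFormDomain.smul {n : ℕ} {V : Rn n → ℝ} {u : L2 n} {Du : Fin n → L2 n} (c : ℂ)
    (h : InFormDomain V u Du) : InFormDomain V (c • u) (c • Du) := by
  refine ⟨fun i => (h.1 i).smul c, (h.2.const_smul c).ae_eq ?_⟩
  filter_upwards [Lp.coeFn_smul c u] with x hx
  simp only [Pi.smul_apply, hx, smul_eq_mul]
  ring

theorem inFormDomain_zero {n : ℕ} (V : Rn n → ℝ) : InFormDomain V (0 : L2 n) 0 := by
  have e0 := Lp.coeFn_zero ℂ 2 (volume : Measure (Rn n))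
  refine ⟨fun i φ hφ hc => ?_, ?_⟩
  · rw [integral_eq_zero_of_ae, integral_eq_zero_of_ae, neg_zero]
    · filter_upwards [e0] with x hx
      simp only [Pi.zero_apply, hx, smul_zero]
    · filter_upwards [e0] with x hx
      simp only [Pi.zero_apply, hx, smul_zero]
  · refine (MemLp.zero' (ε := ℂ)).ae_eq ?_
    filter_upwards [e0] with x hx
    simp only [Pi.zero_apply, hx, mul_zero]

theorem IsElliptic.bounded {n : ℕ} {A : Rn n → Matrix (Fin n) (Fin n) ℝ} (hA : IsElliptic A) :
    ∃ M : ℝ, ∀ x i j, |A x i j| ≤ M := by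
  obtain ⟨lam, h0, -, h⟩ := hA.elliptic
  refine ⟨2 * lam⁻¹, fun x i j => ?_⟩
  have key : ∀ s : ℝ, (∑ k, ∑ l, A x k l *
      (EuclideanSpace.single i 1 + s • EuclideanSpace.single j 1 : Rn n) k *
      (EuclideanSpace.single i 1 + s • EuclideanSpace.single j 1 : Rn n) l)
      = A x i i + 2 * s * A x i j + s ^ 2 * A x j j := by
    intro s
    simp only [PiLp.add_apply, PiLp.smul_apply, PiLp.single_apply, smul_eq_mul, mul_add,
      add_mul, Finset.sum_add_distrib, mul_ite, ite_mul, mul_one, mul_zero, zero_mul,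
      Finset.sum_ite_eq', Finset.mem_univ, if_true]
    rw [hA.symm x j i]
    ring
  have hp := h x (EuclideanSpace.single i 1 + (1 : ℝ) • EuclideanSpace.single j 1)
  have hm := h x (EuclideanSpace.single i 1 + (-1 : ℝ) • EuclideanSpace.single j 1)
  have hi := h x (EuclideanSpace.single i 1 + (0 : ℝ) • EuclideanSpace.single j 1)
  have hj := h x (EuclideanSpace.single j 1 + (0 : ℝ) • EuclideanSpace.single i 1)
  have key' : (∑ k, ∑ l, A x k l *
      (EuclideanSpace.single j 1 + (0 : ℝ) • EuclideanSpace.single i 1 : Rn n) k *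
      (EuclideanSpace.single j 1 + (0 : ℝ) • EuclideanSpace.single i 1 : Rn n) l) = A x j j := by
    simp
  rw [key] at hp hm hi
  rw [key'] at hj
  have n1 : ∀ k : Fin n, ‖(EuclideanSpace.single k 1 : Rn n)‖ = 1 := by simp
  rw [zero_smul, add_zero, n1] at hi hj
  have p1 : 0 ≤ lam * ‖(EuclideanSpace.single i 1 + (1 : ℝ) • EuclideanSpace.single j 1 : Rn n)‖ ^ 2 := by
    positivity
  have p2 : 0 ≤ lam * ‖(EuclideanSpace.single i 1 + (-1 : ℝ) • EuclideanSpace.single j 1 : Rn n)‖ ^ 2 := by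
    positivity
  rw [abs_le]
  constructor <;> nlinarith [hp.1, hm.1, hi.2, hj.2, inv_pos.2 h0]

theorem integrable_mul_conj {n : ℕ} {f g : Rn n → ℂ} (hf : MemLp f 2 volume)
    (hg : MemLp g 2 volume) : Integrable fun x => f x * conj (g x) :=
  memLp_one_iff_integrable.1 (hg.star.mul' (p := 2) (q := 2) (r := 1) hf)

theorem integrable_gradient {n : ℕ} {A : Rn n → Matrix (Fin n) (Fin n) ℝ} (hA : IsElliptic A)
    (Du Dv : Fin n → L2 n) :
    Integrable fun x => ∑ i, ∑ j, (A x i j : ℂ) * Du j x * conj (Dv i x) := by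
  obtain ⟨M, hM⟩ := hA.bounded
  refine integrable_finsetSum _ fun i _ => integrable_finsetSum _ fun j _ => ?_
  have h := (integrable_mul_conj (Lp.memLp (Du j)) (Lp.memLp (Dv i))).bdd_mul (c := M)
    (f := fun x => (A x i j : ℂ))
    (Complex.measurable_ofReal.comp (hA.measurable i j)).aestronglyMeasurable
    (ae_of_all _ fun x => by simpa using hM x i j)
  simpa only [mul_assoc] using h

theorem integrable_potential {n : ℕ} {V : Rn n → ℝ} (hV : ∀ x, 0 ≤ V x) {u v : L2 n}
    {Du Dv : Fin n → L2 n} (hu : InFormDomain V u Du) (hv : InFormDomain V v Dv) :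
    Integrable fun x => (V x : ℂ) * u x * conj (v x) := by
  refine (integrable_mul_conj hu.2 hv.2).congr (ae_of_all _ fun x => ?_)
  have : ((√(V x) : ℝ) : ℂ) * ((√(V x) : ℝ) : ℂ) = (V x : ℂ) := by
    rw [← Complex.ofReal_mul, Real.mul_self_sqrt (hV x)]
  simp only [map_mul, Complex.conj_ofReal]
  rw [← this]
  ring

theorem energyForm_add {n : ℕ} {A : Rn n → Matrix (Fin n) (Fin n) ℝ} (hA : IsElliptic A)
    {V : Rn n → ℝ} (hV : ∀ x, 0 ≤ V x) {u u' v : L2 n} {Du Du' Dv : Fin n → L2 n}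
    (hu : InFormDomain V u Du) (hu' : InFormDomain V u' Du') (hv : InFormDomain V v Dv) :
    energyForm A V (u + u') (Du + Du') v Dv =
      energyForm A V u Du v Dv + energyForm A V u' Du' v Dv := by
  have e1 : (fun x => ∑ i, ∑ j, (A x i j : ℂ) * (Du + Du') j x * conj (Dv i x)) =ᵐ[volume]
      fun x => (∑ i, ∑ j, (A x i j : ℂ) * Du j x * conj (Dv i x)) +
        ∑ i, ∑ j, (A x i j : ℂ) * Du' j x * conj (Dv i x) := by
    filter_upwards [ae_all_iff.2 fun j => Lp.coeFn_add (Du j) (Du' j)] with x hx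
    simp only [Pi.add_apply, hx, mul_add, add_mul, Finset.sum_add_distrib]
  have e2 : (fun x => (V x : ℂ) * (u + u' : L2 n) x * conj (v x)) =ᵐ[volume]
      fun x => (V x : ℂ) * u x * conj (v x) + (V x : ℂ) * u' x * conj (v x) := by
    filter_upwards [Lp.coeFn_add u u'] with x hx
    simp only [hx, Pi.add_apply, mul_add, add_mul]
  unfold energyForm
  rw [integral_congr_ae e1, integral_congr_ae e2,
    integral_add (integrable_gradient hA Du Dv) (integrable_gradient hA Du' Dv),
    integral_add (integrable_potential hV hu hv) (integrable_potential hV hu' hv)]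
  ring

theorem energyForm_smul {n : ℕ} (A : Rn n → Matrix (Fin n) (Fin n) ℝ) (V : Rn n → ℝ) (c : ℂ)
    (u v : L2 n) (Du Dv : Fin n → L2 n) :
    energyForm A V (c • u) (c • Du) v Dv = c * energyForm A V u Du v Dv := by
  have e1 : (fun x => ∑ i, ∑ j, (A x i j : ℂ) * (c • Du) j x * conj (Dv i x)) =ᵐ[volume]
      fun x => c * ∑ i, ∑ j, (A x i j : ℂ) * Du j x * conj (Dv i x) := by
    filter_upwards [ae_all_iff.2 fun j => Lp.coeFn_smul c (Du j)] with x hx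
    simp only [Pi.smul_apply, hx, Finset.mul_sum, smul_eq_mul]
    refine Finset.sum_congr rfl fun i _ => Finset.sum_congr rfl fun j _ => ?_
    ring
  have e2 : (fun x => (V x : ℂ) * (c • u : L2 n) x * conj (v x)) =ᵐ[volume]
      fun x => c * ((V x : ℂ) * u x * conj (v x)) := by
    filter_upwards [Lp.coeFn_smul c u] with x hx
    simp only [hx, Pi.smul_apply, smul_eq_mul]
    ring
  unfold energyForm
  rw [integral_congr_ae e1, integral_congr_ae e2, integral_const_mul, integral_const_mul, mul_add]

/-- The graph of `L = -div (A ∇) + V`: a pair `(u, g)` belongs to it iff `u` is in the form domain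
and the energy form satisfies `a(u, v) = ∫ g conj(v)` for all `v` in the form domain. -/
def schrodingerGraph {n : ℕ} (A : Rn n → Matrix (Fin n) (Fin n) ℝ) (hA : IsElliptic A)
    (V : Rn n → ℝ) (hV : ∀ x, 0 ≤ V x) : Submodule ℂ (L2 n × L2 n) where
  carrier := {p | ∃ Du : Fin n → L2 n, InFormDomain V p.1 Du ∧
    ∀ (v : L2 n) (Dv : Fin n → L2 n), InFormDomain V v Dv →
      energyForm A V p.1 Du v Dv = inner ℂ v p.2}
  add_mem' := by
    rintro p p' ⟨Du, hu, h⟩ ⟨Du', hu', h'⟩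
    refine ⟨Du + Du', hu.add hu', fun v Dv hv => ?_⟩
    rw [Prod.fst_add, Prod.snd_add, energyForm_add hA hV hu hu' hv, h v Dv hv, h' v Dv hv,
      inner_add_right]
  zero_mem' := by
    refine ⟨0, inFormDomain_zero V, fun v Dv _ => ?_⟩
    have := energyForm_smul A V 0 0 v 0 Dv
    simpa using this
  smul_mem' := by
    rintro c p ⟨Du, hu, h⟩
    refine ⟨c • Du, hu.smul c, fun v Dv hv => ?_⟩
    rw [Prod.smul_fst, Prod.smul_snd, energyForm_smul, h v Dv hv, inner_smul_right]

/-- The operator `L = -div (A ∇) + V` on `L²(ℝⁿ)`, i.e. the unbounded operator associated with the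
energy form. -/
def schrodinger {n : ℕ} (A : Rn n → Matrix (Fin n) (Fin n) ℝ) (hA : IsElliptic A)
    (V : Rn n → ℝ) (hV : ∀ x, 0 ≤ V x) : L2 n →ₗ.[ℂ] L2 n :=
  (schrodingerGraph A hA V hV).toLinearPMap

/-! ### Functional calculus of a nonnegative self-adjoint operator

Functions of a nonnegative self-adjoint (unbounded) operator `B` are defined by the continuous
functional calculus of the bounded self-adjoint operator `R = (1 + B)⁻¹`, through the change of
spectral variable `r = (1 + s)⁻¹`, i.e. `s = r⁻¹ - 1`. -/

section FunctionalCalculus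

variable {H : Type*} [NormedAddCommGroup H] [InnerProductSpace ℂ H] [CompleteSpace H]

open Classical in
/-- The bounded operator `(1 + B)⁻¹`, for an operator `B` such that `1 + B` is a bijection from
the domain of `B` onto `H` with bounded inverse (junk value `0` for other `B`). -/
def resolventOne (B : H →ₗ.[ℂ] H) : H →L[ℂ] H :=
  if h : ∃ T : H →L[ℂ] H, ∀ f u : H, T f = u ↔ ∃ hu : u ∈ B.domain, u + B ⟨u, hu⟩ = f
  then h.choose else 0

/-- The power `B ^ s`, `s > 0`, of a nonnegative self-adjoint operator. With `R = (1 + B)⁻¹` one has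
`B = (1 - R) R⁻¹`, and `B ^ s = (1 - R) ^ s (R ^ s)⁻¹`: its domain is the range of `R ^ s`, and it
maps `R ^ s w` to `(1 - R) ^ s w`. -/
def fracPow (B : H →ₗ.[ℂ] H) (s : ℝ) : H →ₗ.[ℂ] H :=
  (LinearMap.range (((cfc (fun r : ℝ => r ^ s) (resolventOne B)).prod
    (cfc (fun r : ℝ => (1 - r) ^ s) (resolventOne B)) : H →L[ℂ] H × H) :
      H →ₗ[ℂ] H × H)).toLinearPMap

/-- The operator `exp (-t B)`, `t > 0`, of the semigroup generated by `-B`, for a nonnegative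
self-adjoint operator `B`. -/
def expNeg (B : H →ₗ.[ℂ] H) (t : ℝ) : H →L[ℂ] H :=
  cfc (fun r : ℝ => if r ≤ 0 then 0 else Real.exp (-t * (r⁻¹ - 1))) (resolventOne B)

open Classical in
/-- `t ^ (β / α) B ^ β exp (-t B ^ α) f`, where `exp (-t B ^ α) f` is in the domain of `B ^ β`
(junk value `0` otherwise). -/
def fracHeat (B : H →ₗ.[ℂ] H) (α β t : ℝ) (f : H) : H :=
  if hf : expNeg (fracPow B α) t f ∈ (fracPow B β).domain
  then ((t ^ (β / α) : ℝ) : ℂ) • fracPow B β ⟨expNeg (fracPow B α) t f, hf⟩ else 0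

end FunctionalCalculus

/-- The measure `dx dt / t` on the upper half-space `ℝⁿ × (0, ∞)`. -/
def halfSpaceMeasure (n : ℕ) : Measure (Rn n × ℝ) :=
  (volume : Measure (Rn n)).prod
    (((volume : Measure ℝ).restrict (Ioi 0)).withDensity fun t => ENNReal.ofReal (1 / t))

end

/-! Put `p = β / α`. In the spectral variable `s ≥ 0` of `L`, the operator `D_t` is multiplication
by `(t s^α)^p e^{-t s^α}`. For `s > 0` the substitution `σ = t s^α` turns `∫_0^∞ (t s^α)^{2p} e^{-2
t s^α} dt/t` into `m = ∫_0^∞ σ^{2p-1} e^{-2σ} dσ`, which does not depend on `s`; hence `c = 1/m`.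
With `Ψ` the primitive of the last integrand divided by `m`, increasing from 0 at 0 to 1 at
infinity, this gives `c ∫_ε^N D_t² f dt/t = Ψ(N L^α) f - Ψ(ε L^α) f` (`integral_heatOp_sq`).

The second term tends to 0 strongly. The first tends to `f` because `L` has trivial kernel: `L u =
0` forces `∇u = 0` by ellipticity and `V ≥ 0`, and an `L²` function with a vanishing weak derivative
is zero (`eq_zero_of_hasWeakDeriv_zero`). This is the reproducing formula; pairing it with `f` and
using that `D_t` is self-adjoint gives the square function identity, and Tonelli's theorem turns
`L²(dt/t; L²)` into `L²(dx dt/t)` (`uncurryLp`).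

Everything is done with the continuous functional calculus of `R = (1 + L)⁻¹`, whose spectrum lies
in `[0, 1]`, through `r = (1 + s)⁻¹`. Functions of `s` with a limit at infinity become continuous at
`r = 0`. No spectral measure is needed: the strong limits follow from explicit norm estimates on the
dense ranges of powers of `R` and of `1 - R` (`tendsto_zero_of_tendsto_comp`). The required
properties of `R` are collected in `IsResolvent`; for the Schrödinger operator they come from a
Lax–Milgram argument on the closed form domain (`isResolvent_formResolvent`). -/

/-! ### Functions of the spectral variable -/

/-- The function `K (t s ^ α)` of the spectral variable `s ≥ 0`, written in the variable
`r = (1 + s)⁻¹`; its value `l` at `r = 0` stands for the limit of `K` at infinity. -/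
noncomputable def spectralLift (K : ℝ → ℝ) (l α t r : ℝ) : ℝ :=
  if r ≤ 0 then l else K (t * (r⁻¹ - 1) ^ α)

theorem spectralLift_of_pos (K : ℝ → ℝ) (l α t : ℝ) {r : ℝ} (hr : 0 < r) :
    spectralLift K l α t r = K (t * (r⁻¹ - 1) ^ α) := if_neg hr.not_ge

theorem spectralLift_zero (K : ℝ → ℝ) (l α t : ℝ) : spectralLift K l α t 0 = l := if_pos le_rfl

theorem inv_sub_one_nonneg {r : ℝ} (hr : 0 < r) (hr1 : r ≤ 1) : 0 ≤ r⁻¹ - 1 :=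
  sub_nonneg.2 ((one_le_inv₀ hr).2 hr1)

/-- As `(t', r)` tends to `(t, 0)` with `t > 0` and `r > 0`, the argument of `K` tends to infinity,
so the value `l` fills in continuously. Joint continuity serves both norm continuity in `t` and the
exchange of integral and functional calculus. -/
theorem continuousOn_spectralLift {K : ℝ → ℝ} {l α : ℝ} (hα : 0 < α)
    (hK : ContinuousOn K (Ici 0)) (hl : Tendsto K atTop (𝓝 l)) :
    ContinuousOn (fun p : ℝ × ℝ => spectralLift K l α p.1 p.2) (Ioi 0 ×ˢ Icc 0 1) := by
  rintro ⟨t, r⟩ ⟨ht, hr0, hr1⟩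
  simp only [mem_Ioi] at ht hr0 hr1
  rcases hr0.eq_or_lt with rfl | hr
  · rw [ContinuousWithinAt, spectralLift_zero]
    refine Tendsto.if ?_ ?_
    · exact tendsto_const_nhds
    · refine hl.comp ?_
      have h2 : Tendsto (fun p : ℝ × ℝ => p.2) (𝓝[Ioi 0 ×ˢ Icc 0 1] (t, 0) ⊓
          𝓟 {p : ℝ × ℝ | ¬ p.2 ≤ 0}) (𝓝[>] 0) := by
        refine tendsto_nhdsWithin_iff.2 ⟨?_, ?_⟩
        · exact (continuous_snd.tendsto (t, (0 : ℝ))).mono_left (inf_le_left.trans inf_le_left)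
        · refine mem_inf_of_right ?_
          intro p hp
          simpa using hp
      have h1 : Tendsto (fun p : ℝ × ℝ => p.1) (𝓝[Ioi 0 ×ˢ Icc 0 1] (t, 0) ⊓
          𝓟 {p : ℝ × ℝ | ¬ p.2 ≤ 0}) (𝓝 t) :=
        (continuous_fst.tendsto (t, (0 : ℝ))).mono_left (inf_le_left.trans inf_le_left)
      exact h1.pos_mul_atTop ht ((tendsto_rpow_atTop hα).comp
        (tendsto_atTop_add_const_right _ _ (tendsto_inv_nhdsGT_zero.comp h2)))
  · have h1 : ContinuousWithinAt (fun p : ℝ × ℝ => K (p.1 * (p.2⁻¹ - 1) ^ α))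
        (Ioi 0 ×ˢ Ioc 0 1) (t, r) := by
      refine ContinuousWithinAt.comp (t := Ici 0)
        (f := fun p : ℝ × ℝ => p.1 * (p.2⁻¹ - 1) ^ α) (hK _ ?_) ?_ ?_
      · exact mul_nonneg ht.le (Real.rpow_nonneg (inv_sub_one_nonneg hr hr1) _)
      · refine ContinuousAt.continuousWithinAt ?_
        refine continuousAt_fst.mul ?_
        refine ContinuousAt.rpow_const ?_ (Or.inr hα.le)
        exact (continuousAt_snd.inv₀ hr.ne').sub continuousAt_const
      · rintro ⟨s, x⟩ ⟨hs, hx0, hx1⟩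
        exact mul_nonneg (le_of_lt hs) (Real.rpow_nonneg (inv_sub_one_nonneg hx0 hx1) _)
    have h2 : ContinuousWithinAt (fun p : ℝ × ℝ => spectralLift K l α p.1 p.2)
        (Ioi 0 ×ˢ Ioc 0 1) (t, r) := by
      refine h1.congr ?_ (spectralLift_of_pos _ _ _ _ hr)
      rintro ⟨s, x⟩ ⟨-, hx0, -⟩
      exact spectralLift_of_pos _ _ _ _ hx0
    refine h2.mono_of_mem_nhdsWithin ?_
    have : {p : ℝ × ℝ | 0 < p.2} ∈ 𝓝 (t, r) := (isOpen_lt continuous_const continuous_snd).mem_nhds hr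
    filter_upwards [self_mem_nhdsWithin, mem_nhdsWithin_of_mem_nhds this] with p hp hp2
    exact ⟨hp.1, hp2, hp.2.2⟩

theorem continuousOn_spectralLift_right {K : ℝ → ℝ} {l α t : ℝ} (hα : 0 < α) (ht : 0 < t)
    (hK : ContinuousOn K (Ici 0)) (hl : Tendsto K atTop (𝓝 l)) :
    ContinuousOn (spectralLift K l α t) (Icc 0 1) :=
  (continuousOn_spectralLift hα hK hl).comp (f := fun r => (t, r))
    (Continuous.prodMk_right t).continuousOn fun _ hr => ⟨ht, hr⟩

theorem continuousOn_rpow_left {s : ℝ} (hs : 0 < s) : ContinuousOn (fun r : ℝ => r ^ s) (Icc 0 1) :=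
  (Real.continuous_rpow_const hs.le).continuousOn

theorem continuousOn_rpow_right {s : ℝ} (hs : 0 < s) :
    ContinuousOn (fun r : ℝ => (1 - r) ^ s) (Icc 0 1) :=
  ((Real.continuous_rpow_const hs.le).comp (continuous_const.sub continuous_id)).continuousOn

theorem rpow_add_rpow_pos {s r : ℝ} (hs : 0 < s) (hr : r ∈ Icc (0 : ℝ) 1) :
    0 < r ^ s + (1 - r) ^ s := by
  rcases hr.1.eq_or_lt with h | h
  · rw [← h, Real.zero_rpow hs.ne']; simp
  · exact add_pos_of_pos_of_nonneg (Real.rpow_pos_of_pos h _)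
      (Real.rpow_nonneg (sub_nonneg.2 hr.2) _)

/-- The profile `x ^ p e ^ (-x)`; with `p = β / α` the operator `t ^ (β / α) B ^ β exp (-t B ^ α)`
is this function of `t B ^ α`. -/
noncomputable def heatProfile (p x : ℝ) : ℝ := x ^ p * Real.exp (-x)

theorem continuous_heatProfile {p : ℝ} (hp : 0 < p) : Continuous (heatProfile p) :=
  (Real.continuous_rpow_const hp.le).mul (by fun_prop)

theorem tendsto_heatProfile (p : ℝ) : Tendsto (heatProfile p) atTop (𝓝 0) :=
  tendsto_rpow_mul_exp_neg_mul_atTop_nhds_zero p 1 one_pos |>.congr fun x => by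
    simp [heatProfile]

theorem tendsto_exp_neg : Tendsto (fun x : ℝ => Real.exp (-x)) atTop (𝓝 0) :=
  Real.tendsto_exp_atBot.comp tendsto_neg_atTop_atBot

/-- The function of `x = t s ^ α` which equals `exp (-t s ^ α) (1 + s) ^ β`. -/
noncomputable def domainProfile (α β t x : ℝ) : ℝ := Real.exp (-x) * (1 + (x / t) ^ α⁻¹) ^ β

theorem continuous_domainProfile {α β t : ℝ} (hα : 0 < α) (hβ : 0 < β) :
    Continuous (domainProfile α β t) :=
  Continuous.mul (by fun_prop) ((Real.continuous_rpow_const hβ.le).comp (continuous_const.add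
    ((Real.continuous_rpow_const (inv_nonneg.2 hα.le)).comp (continuous_id.div_const t))))

/-- For `x ≥ t` the summand 1 is at most `(x / t)^{1/α}`, so the profile is bounded by a constant
times `x^{β/α} e^{-x}`. -/
theorem tendsto_domainProfile {α β t : ℝ} (hα : 0 < α) (hβ : 0 < β) (ht : 0 < t) :
    Tendsto (domainProfile α β t) atTop (𝓝 0) := by
  have h := (tendsto_heatProfile (α⁻¹ * β)).const_mul (2 ^ β * (t⁻¹) ^ (α⁻¹ * β))
  rw [mul_zero] at h
  refine tendsto_of_tendsto_of_tendsto_of_le_of_le' tendsto_const_nhds h ?_ ?_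
  · filter_upwards [eventually_ge_atTop 0] with x hx
    have : 0 ≤ x / t := by positivity
    unfold domainProfile
    positivity
  · filter_upwards [eventually_ge_atTop t] with x hx
    have h0 : 0 ≤ x := ht.le.trans hx
    have h1 : 1 ≤ x / t := (one_le_div ht).2 hx
    have h2 : 1 ≤ (x / t) ^ α⁻¹ := Real.one_le_rpow h1 (inv_nonneg.2 hα.le)
    have h3 : (1 + (x / t) ^ α⁻¹) ^ β ≤ (2 * (x / t) ^ α⁻¹) ^ β :=
      Real.rpow_le_rpow (by positivity) (by linarith) hβ.le
    have h4 : (2 * (x / t) ^ α⁻¹) ^ β = 2 ^ β * (t⁻¹ ^ (α⁻¹ * β) * x ^ (α⁻¹ * β)) := by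
      rw [Real.mul_rpow zero_le_two (by positivity), ← Real.rpow_mul (by positivity),
        div_eq_inv_mul, Real.mul_rpow (by positivity) h0]
    calc domainProfile α β t x ≤ Real.exp (-x) * (2 * (x / t) ^ α⁻¹) ^ β := by
          unfold domainProfile
          gcongr
      _ = _ := by rw [h4, heatProfile]; ring

/-! ### Functional calculus of a resolvent -/

section

variable {H : Type*} [NormedAddCommGroup H] [InnerProductSpace ℂ H] [CompleteSpace H]

/-- The properties of `R = (1 + B)⁻¹` for an injective nonnegative self-adjoint operator `B`. -/
structure IsResolvent (R : H →L[ℂ] H) : Prop where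
  isSelfAdjoint : IsSelfAdjoint R
  spectrum_subset : spectrum ℝ R ⊆ Icc 0 1
  injective : ∀ f, R f = 0 → f = 0
  no_fixed : ∀ f, R f = f → f = 0

/-- `Submodule.toLinearPMap` has the given submodule as its graph only if a zero first component
forces a zero second one; injectivity of the first component of `T` ensures this. -/
theorem LinearMap.mem_graph_toLinearPMap_range_prod {E F G : Type*} [AddCommGroup E] [Module ℂ E]
    [AddCommGroup F] [Module ℂ F] [AddCommGroup G] [Module ℂ G] (T : E →ₗ[ℂ] F × G)
    (hT : ∀ w, (T w).1 = 0 → w = 0) (p : F × G) :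
    p ∈ (LinearMap.range T).toLinearPMap.graph ↔ ∃ w, T w = p := by
  rw [Submodule.toLinearPMap_graph_eq]
  · rfl
  · rintro _ ⟨w, rfl⟩ h
    rw [hT w h, map_zero, Prod.snd_zero]

omit [CompleteSpace H] in
theorem resolventOne_eq {B : H →ₗ.[ℂ] H} {T : H →L[ℂ] H}
    (hT : ∀ f u : H, T f = u ↔ ∃ hu : u ∈ B.domain, u + B ⟨u, hu⟩ = f) : resolventOne B = T := by
  have h : ∃ T : H →L[ℂ] H, ∀ f u : H, T f = u ↔ ∃ hu : u ∈ B.domain, u + B ⟨u, hu⟩ = f := ⟨T, hT⟩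
  rw [resolventOne, dif_pos h]
  ext f
  exact (h.choose_spec f (T f)).2 ((hT f (T f)).1 rfl)

omit [CompleteSpace H] in
theorem exists_add_apply_eq_iff (B : H →ₗ.[ℂ] H) (f u : H) :
    (∃ hu : u ∈ B.domain, u + B ⟨u, hu⟩ = f) ↔ (u, f - u) ∈ B.graph := by
  rw [LinearPMap.mem_graph_iff]
  constructor
  · rintro ⟨hu, rfl⟩
    exact ⟨⟨u, hu⟩, rfl, by simp⟩
  · rintro ⟨⟨y, hy⟩, rfl, h⟩
    exact ⟨hy, by rw [h]; simp⟩

namespace IsResolvent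

variable {R : H →L[ℂ] H} (hR : IsResolvent R)
include hR

theorem cfc_mul_apply {f g : ℝ → ℝ} (hf : ContinuousOn f (Icc 0 1)) (hg : ContinuousOn g (Icc 0 1))
    (x : H) : cfc (fun r => f r * g r) R x = cfc f R (cfc g R x) := by
  rw [cfc_mul f g R (hf.mono hR.spectrum_subset) (hg.mono hR.spectrum_subset)]
  rfl

theorem cfc_congr {f g : ℝ → ℝ} (h : ∀ r ∈ Icc (0 : ℝ) 1, f r = g r) : cfc f R = cfc g R :=
  _root_.cfc_congr fun r hr => h r (hR.spectrum_subset hr)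

theorem norm_cfc_le {f : ℝ → ℝ} {c : ℝ} (hc : 0 ≤ c) (h : ∀ r ∈ Icc (0 : ℝ) 1, |f r| ≤ c) :
    ‖cfc f R‖ ≤ c :=
  _root_.norm_cfc_le hc fun r hr => h r (hR.spectrum_subset hr)

/-- For an integer `k > s` one has `φ^k = φ^{k-s} φ^s`, so the kernel of `φ^s` lies in that of
`φ^k`, and natural powers of an injective operator are injective. -/
theorem cfc_rpow_eq_zero {φ : ℝ → ℝ} (hφ : ContinuousOn φ (Icc 0 1))
    (h0 : ∀ r ∈ Icc (0 : ℝ) 1, 0 ≤ φ r) (hinj : ∀ x, cfc φ R x = 0 → x = 0) {s : ℝ} (hs : 0 < s)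
    {x : H} (hx : cfc (fun r => φ r ^ s) R x = 0) : x = 0 := by
  obtain ⟨k, hk⟩ := exists_nat_gt s
  have hpow : ∀ (m : ℕ) (y : H), cfc (fun r => φ r ^ m) R y = 0 → y = 0 := by
    intro m
    induction m with
    | zero =>
      intro y hy
      simp only [pow_zero] at hy
      rwa [cfc_const_one ℝ R hR.isSelfAdjoint] at hy
    | succ m ih =>
      intro y hy
      simp only [pow_succ] at hy
      rw [hR.cfc_mul_apply (f := fun r => φ r ^ m) (hφ.pow m) hφ] at hy
      exact hinj _ (ih _ hy)
  refine hpow k x ?_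
  have e : cfc (fun r => φ r ^ k) R = cfc (fun r => φ r ^ (k - s) * φ r ^ s) R := by
    refine hR.cfc_congr fun r hr => ?_
    rw [← Real.rpow_add' (h0 r hr) (by simpa using (hs.trans hk).ne'), sub_add_cancel,
      Real.rpow_natCast]
  rw [e, hR.cfc_mul_apply (hφ.rpow_const fun _ _ => Or.inr (by linarith))
    (hφ.rpow_const fun _ _ => Or.inr hs.le), hx, map_zero]

theorem cfc_rpow_left {s : ℝ} (hs : 0 < s) {x : H} (hx : cfc (fun r : ℝ => r ^ s) R x = 0) :
    x = 0 := by
  refine hR.cfc_rpow_eq_zero (φ := fun r => r) continuousOn_id (fun r hr => hr.1) ?_ hs hx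
  intro y hy
  rw [cfc_id' ℝ R hR.isSelfAdjoint] at hy
  exact hR.injective y hy

theorem cfc_rpow_right {s : ℝ} (hs : 0 < s) {x : H}
    (hx : cfc (fun r : ℝ => (1 - r) ^ s) R x = 0) : x = 0 := by
  refine hR.cfc_rpow_eq_zero (φ := fun r => 1 - r) (continuousOn_const.sub continuousOn_id)
    (fun r hr => sub_nonneg.2 hr.2) ?_ hs hx
  intro y hy
  rw [cfc_sub (fun _ => (1 : ℝ)) (fun r => r) R, cfc_id' ℝ R hR.isSelfAdjoint,
    cfc_const_one ℝ R hR.isSelfAdjoint] at hy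
  exact hR.no_fixed y (sub_eq_zero.1 hy).symm

end IsResolvent

variable {B : H →ₗ.[ℂ] H} (hR : IsResolvent (resolventOne B))
include hR

theorem mem_fracPow_graph {s : ℝ} (hs : 0 < s) (u v : H) :
    (u, v) ∈ (fracPow B s).graph ↔ ∃ w, cfc (fun r : ℝ => r ^ s) (resolventOne B) w = u ∧
      cfc (fun r : ℝ => (1 - r) ^ s) (resolventOne B) w = v := by
  rw [fracPow, LinearMap.mem_graph_toLinearPMap_range_prod]
  · simp
  · intro w hw
    exact hR.cfc_rpow_left hs (by simpa using hw)

/-- With spectral variable `(1 - r) / r`, the function `(1 + ((1 - r) / r)^s)⁻¹` equals `r^s / (r^s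
+ (1 - r)^s)`, in which nothing degenerates at `r = 0`. -/
theorem resolventOne_fracPow {s : ℝ} (hs : 0 < s) :
    resolventOne (fracPow B s) =
      cfc (fun r : ℝ => r ^ s * (r ^ s + (1 - r) ^ s)⁻¹) (resolventOne B) := by
  have c1 := continuousOn_rpow_left hs
  have c2 := continuousOn_rpow_right hs
  have c3 : ContinuousOn (fun r : ℝ => (r ^ s + (1 - r) ^ s)⁻¹) (Icc 0 1) :=
    (c1.add c2).inv₀ fun r hr => (rpow_add_rpow_pos hs hr).ne'
  have hadd : ∀ w, cfc (fun r : ℝ => r ^ s) (resolventOne B) w +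
      cfc (fun r : ℝ => (1 - r) ^ s) (resolventOne B) w =
      cfc (fun r : ℝ => r ^ s + (1 - r) ^ s) (resolventOne B) w := by
    intro w
    rw [cfc_add (resolventOne B) (fun r : ℝ => r ^ s) (fun r : ℝ => (1 - r) ^ s)
      (c1.mono hR.spectrum_subset) (c2.mono hR.spectrum_subset)]
    rfl
  have hone : ∀ w, cfc (fun r : ℝ => (r ^ s + (1 - r) ^ s) * (r ^ s + (1 - r) ^ s)⁻¹)
      (resolventOne B) w = w := by
    intro w
    rw [hR.cfc_congr (g := fun _ => 1)
      fun r hr => mul_inv_cancel₀ (rpow_add_rpow_pos hs hr).ne',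
      cfc_const_one ℝ _ hR.isSelfAdjoint]
    rfl
  refine resolventOne_eq fun f u => ?_
  rw [exists_add_apply_eq_iff, mem_fracPow_graph hR hs, hR.cfc_mul_apply c1 c3]
  constructor
  · rintro rfl
    refine ⟨_, rfl, ?_⟩
    rw [eq_sub_iff_add_eq', hadd, ← hR.cfc_mul_apply (f := fun r : ℝ => r ^ s + (1 - r) ^ s) (c1.add c2) c3, hone]
  · rintro ⟨w, rfl, hw⟩
    rw [eq_sub_iff_add_eq', hadd] at hw
    rw [← hw, ← hR.cfc_mul_apply (g := fun r : ℝ => r ^ s + (1 - r) ^ s) c3 (c1.add c2)]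
    simp only [mul_comm _ (_ + _ : ℝ)]
    rw [hone]

/-- `expNeg` is defined through the resolvent of `fracPow B α`, itself a function of `resolventOne
B`; composing the two functional calculi gives a single function of `resolventOne B`. -/
theorem expNeg_fracPow {α t : ℝ} (hα : 0 < α) (ht : 0 < t) :
    expNeg (fracPow B α) t =
      cfc (spectralLift (fun x => Real.exp (-x)) 0 α t) (resolventOne B) := by
  have c1 := continuousOn_rpow_left hα
  have c2 := continuousOn_rpow_right hα
  have c3 : ContinuousOn (fun r : ℝ => r ^ α * (r ^ α + (1 - r) ^ α)⁻¹) (Icc 0 1) :=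
    c1.mul ((c1.add c2).inv₀ fun r hr => (rpow_add_rpow_pos hα hr).ne')
  have hmaps : MapsTo (fun r : ℝ => r ^ α * (r ^ α + (1 - r) ^ α)⁻¹) (Icc 0 1) (Icc 0 1) := by
    intro r hr
    have h1 := Real.rpow_nonneg hr.1 α
    have h2 := Real.rpow_nonneg (sub_nonneg.2 hr.2) α
    have h3 := rpow_add_rpow_pos hα hr
    refine ⟨by positivity, ?_⟩
    simp only [← div_eq_mul_inv]
    rw [div_le_one h3]
    linarith
  have c4 : ContinuousOn (fun r : ℝ => if r ≤ 0 then 0 else Real.exp (-t * (r⁻¹ - 1)))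
      (Icc 0 1) := by
    refine (continuousOn_spectralLift_right (K := fun x => Real.exp (-x)) one_pos ht
      (by fun_prop) tendsto_exp_neg).congr fun r hr => ?_
    simp [spectralLift]
  rw [expNeg, resolventOne_fracPow hR hα, ← cfc_comp' _ _ _ (c4.mono
    ((image_mono hR.spectrum_subset).trans hmaps.image_subset)) (c3.mono hR.spectrum_subset)
    hR.isSelfAdjoint]
  · refine hR.cfc_congr fun r hr => ?_
    -- At `r = 0` the inner function vanishes because `0^α = 0`, so both sides take their default
    -- value 0.
    rcases hr.1.eq_or_lt with rfl | h
    · simp [spectralLift_zero, Real.zero_rpow hα.ne']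
    · have h1 := Real.rpow_pos_of_pos h α
      have h3 := rpow_add_rpow_pos hα hr
      rw [spectralLift_of_pos _ _ _ _ h, if_neg (by rw [not_le]; positivity)]
      congr 1
      rw [show r⁻¹ - 1 = (1 - r) / r by field_simp, Real.div_rpow (sub_nonneg.2 hr.2) h.le]
      field_simp
      ring

/-- The function `k = e^{-t s^α} (1 + s)^β` is bounded and `e^{-t s^α} = r^β k`, so the semigroup
maps into the range of `R^β`, which is the domain of `B^β`. Since `(1 - r)(1 + s) = s`, the value
there is `(1 - r)^β k = s^β e^{-t s^α}`, and `t^{β/α}` completes the profile. -/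
theorem fracHeat_spec {α β t : ℝ} (hα : 0 < α) (hβ : 0 < β) (ht : 0 < t) (f : H) :
    ∃ hf : expNeg (fracPow B α) t f ∈ (fracPow B β).domain,
      ((t ^ (β / α) : ℝ) : ℂ) • fracPow B β ⟨expNeg (fracPow B α) t f, hf⟩ =
        cfc (spectralLift (heatProfile (β / α)) 0 α t) (resolventOne B) f := by
  have ck := continuousOn_spectralLift_right hα ht
    (continuous_domainProfile (t := t) hα hβ).continuousOn (tendsto_domainProfile hα hβ ht)
  have key : ∀ r : ℝ, 0 < r → r ≤ 1 →
      (t * (r⁻¹ - 1) ^ α / t) ^ α⁻¹ = r⁻¹ - 1 := by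
    intro r h h1
    rw [mul_div_cancel_left₀ _ ht.ne', Real.rpow_rpow_inv (inv_sub_one_nonneg h h1) hα.ne']
  have hmem : (expNeg (fracPow B α) t f, cfc (fun r : ℝ => (1 - r) ^ β) (resolventOne B)
      (cfc (spectralLift (domainProfile α β t) 0 α t) (resolventOne B) f)) ∈
      (fracPow B β).graph := by
    refine (mem_fracPow_graph hR hβ _ _).2 ⟨_, ?_, rfl⟩
    rw [expNeg_fracPow hR hα ht, ← hR.cfc_mul_apply (continuousOn_rpow_left hβ) ck]
    congr 1
    refine hR.cfc_congr fun r hr => ?_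
    rcases hr.1.eq_or_lt with rfl | h
    · simp [spectralLift_zero]
    · rw [spectralLift_of_pos _ _ _ _ h, spectralLift_of_pos _ _ _ _ h, domainProfile,
        key r h hr.2, add_sub_cancel, Real.inv_rpow h.le]
      have := Real.rpow_pos_of_pos h β
      field_simp
  obtain ⟨⟨y, hy⟩, h1, h2⟩ := (LinearPMap.mem_graph_iff _).1 hmem
  simp only at h1 h2
  subst h1
  refine ⟨hy, ?_⟩
  rw [h2, ← hR.cfc_mul_apply (continuousOn_rpow_right hβ) ck, Complex.coe_smul,
    ← _root_.smul_apply, ← cfc_smul _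
      (fun r : ℝ => (1 - r) ^ β * spectralLift (domainProfile α β t) 0 α t r) _
      (((continuousOn_rpow_right hβ).mul ck).mono hR.spectrum_subset)]
  congr 1
  refine hR.cfc_congr fun r hr => ?_
  rcases hr.1.eq_or_lt with rfl | h
  · simp [spectralLift_zero]
  · have hpow : (r⁻¹ - 1) ^ β = (1 - r) ^ β * r⁻¹ ^ β := by
      rw [show r⁻¹ - 1 = (1 - r) * r⁻¹ by field_simp,
        Real.mul_rpow (sub_nonneg.2 hr.2) (inv_nonneg.2 h.le)]
    rw [spectralLift_of_pos _ _ _ _ h, spectralLift_of_pos _ _ _ _ h, domainProfile, heatProfile,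
      key r h hr.2, add_sub_cancel, Real.mul_rpow ht.le
        (Real.rpow_nonneg (inv_sub_one_nonneg h hr.2) _),
      ← Real.rpow_mul (inv_sub_one_nonneg h hr.2), mul_div_cancel₀ _ hα.ne', smul_eq_mul, hpow]
    ring

theorem expNeg_mem_domain {α β t : ℝ} (hα : 0 < α) (hβ : 0 < β) (ht : 0 < t) (f : H) :
    expNeg (fracPow B α) t f ∈ (fracPow B β).domain :=
  (fracHeat_spec hR hα hβ ht f).1

theorem fracHeat_eq {α β t : ℝ} (hα : 0 < α) (hβ : 0 < β) (ht : 0 < t) (f : H) :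
    fracHeat B α β t f =
      cfc (spectralLift (heatProfile (β / α)) 0 α t) (resolventOne B) f := by
  obtain ⟨hf, h⟩ := fracHeat_spec hR hα hβ ht f
  rw [fracHeat, dif_pos hf, h]

end

/-! ### The normalizing integral -/

/-- The density `heatProfile p s ^ 2 / s` on the positive half-line. -/
noncomputable def heatDensity (p : ℝ) : ℝ → ℝ :=
  (Ioi 0).indicator fun s => s ^ (2 * p - 1) * Real.exp (-(2 * s))

/-- The integral of `heatDensity p`. -/
noncomputable def heatMass (p : ℝ) : ℝ := ∫ s, heatDensity p s

theorem heatDensity_of_pos (p : ℝ) {s : ℝ} (hs : 0 < s) :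
    heatDensity p s = s ^ (2 * p - 1) * Real.exp (-(2 * s)) := indicator_of_mem hs _

theorem heatDensity_nonneg (p s : ℝ) : 0 ≤ heatDensity p s :=
  indicator_nonneg (fun x (hx : 0 < x) => by positivity) s

theorem heatMass_pos {p : ℝ} (hp : 0 < p) : 0 < heatMass p := by
  unfold heatMass heatDensity
  rw [integral_indicator measurableSet_Ioi,
    Real.integral_rpow_mul_exp_neg_mul_Ioi (by positivity) two_pos]
  have := Real.Gamma_pos_of_pos (show 0 < 2 * p by positivity)
  positivity

theorem integrableOn_rpow_mul_exp {s : ℝ} (hs : -1 < s) :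
    IntegrableOn (fun x : ℝ => x ^ s * Real.exp (-(2 * x))) (Ioi 0) := by
  simpa using integrableOn_rpow_mul_exp_neg_mul_rpow hs one_pos two_pos

theorem integrable_heatDensity {p : ℝ} (hp : 0 < p) : Integrable (heatDensity p) :=
  (integrable_indicator_iff measurableSet_Ioi).2 (integrableOn_rpow_mul_exp (by linarith))

/-- The normalized primitive of `heatDensity p`. -/
noncomputable def heatPrimitive (p x : ℝ) : ℝ := (heatMass p)⁻¹ * ∫ s in 0..x, heatDensity p s

theorem continuous_heatPrimitive {p : ℝ} (hp : 0 < p) : Continuous (heatPrimitive p) :=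
  continuous_const.mul (intervalIntegral.continuous_primitive
    (fun _ _ => (integrable_heatDensity hp).intervalIntegrable) 0)

theorem heatMass_eq_Ioi (p : ℝ) : heatMass p = ∫ s in Ioi 0, heatDensity p s := by
  rw [heatMass, ← integral_indicator measurableSet_Ioi]
  congr 1
  ext s
  by_cases hs : s ∈ Ioi (0 : ℝ)
  · rw [indicator_of_mem hs]
  · rw [indicator_of_notMem hs, heatDensity, indicator_of_notMem hs]

theorem tendsto_heatPrimitive {p : ℝ} (hp : 0 < p) : Tendsto (heatPrimitive p) atTop (𝓝 1) := by
  have h := (intervalIntegral_tendsto_integral_Ioi 0 (integrable_heatDensity hp).integrableOn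
    tendsto_id).const_mul (heatMass p)⁻¹
  rwa [← heatMass_eq_Ioi, inv_mul_cancel₀ (heatMass_pos hp).ne'] at h

theorem heatPrimitive_nonneg {p x : ℝ} (hp : 0 < p) (hx : 0 ≤ x) : 0 ≤ heatPrimitive p x :=
  mul_nonneg (inv_nonneg.2 (heatMass_pos hp).le)
    (intervalIntegral.integral_nonneg hx fun s _ => heatDensity_nonneg p s)

theorem one_sub_heatPrimitive {p : ℝ} (hp : 0 < p) (x : ℝ) :
    1 - heatPrimitive p x = (heatMass p)⁻¹ * ∫ s in Ioi x, heatDensity p s := by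
  have h := intervalIntegral.integral_interval_add_Ioi (a := 0) (b := x)
    (integrable_heatDensity hp).integrableOn (integrable_heatDensity hp).integrableOn
  rw [← heatMass_eq_Ioi] at h
  have hm := heatMass_pos hp
  rw [heatPrimitive, sub_eq_iff_eq_add, ← mul_add, add_comm, h, inv_mul_cancel₀ hm.ne']

theorem heatPrimitive_le_one {p : ℝ} (hp : 0 < p) (x : ℝ) : heatPrimitive p x ≤ 1 := by
  rw [← sub_nonneg, one_sub_heatPrimitive hp]
  exact mul_nonneg (inv_nonneg.2 (heatMass_pos hp).le)
    (setIntegral_nonneg measurableSet_Ioi fun s _ => heatDensity_nonneg p s)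

/-- Bounding the exponential by 1 leaves the integral of `s^{2p-1}`. This is the decay rate used as
`t → 0`. -/
theorem exists_heatPrimitive_le {p : ℝ} (hp : 0 < p) :
    ∃ C, 0 ≤ C ∧ ∀ x, 0 ≤ x → heatPrimitive p x ≤ C * x ^ (2 * p) := by
  have hm := heatMass_pos hp
  refine ⟨(heatMass p)⁻¹ * (2 * p)⁻¹, by positivity, fun x hx => ?_⟩
  rw [heatPrimitive, mul_assoc]
  refine mul_le_mul_of_nonneg_left ?_ (inv_nonneg.2 hm.le)
  have h1 : ∫ s in 0..x, heatDensity p s ≤ ∫ s in 0..x, s ^ (2 * p - 1) := by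
    refine intervalIntegral.integral_mono_on_of_le_Ioo hx
      (integrable_heatDensity hp).intervalIntegrable
      (intervalIntegral.intervalIntegrable_rpow' (by linarith)) fun s hs => ?_
    rw [heatDensity_of_pos p hs.1]
    have : Real.exp (-(2 * s)) ≤ 1 := Real.exp_le_one_iff.2 (by linarith [hs.1])
    exact mul_le_of_le_one_right (Real.rpow_nonneg hs.1.le _) this
  rw [integral_rpow (Or.inl (by linarith)), sub_add_cancel, Real.zero_rpow (by positivity),
    sub_zero] at h1
  rwa [inv_mul_eq_div]

/-- Markov's inequality with the finite first moment of the density. This is the decay rate used as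
`t → ∞`. -/
theorem exists_one_sub_heatPrimitive_le {p : ℝ} (hp : 0 < p) :
    ∃ C, 0 ≤ C ∧ ∀ x, 0 < x → 1 - heatPrimitive p x ≤ C * x⁻¹ := by
  have hm := heatMass_pos hp
  have hi : IntegrableOn (fun s : ℝ => s * heatDensity p s) (Ioi 0) := by
    refine (integrableOn_rpow_mul_exp (s := 2 * p) (by linarith)).congr_fun (fun s hs => ?_)
      measurableSet_Ioi
    simp only [heatDensity_of_pos p hs]
    rw [← mul_assoc, ← Real.rpow_one_add' (le_of_lt hs) (by linarith)]
    ring_nf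
  have hn : 0 ≤ ∫ s in Ioi 0, s * heatDensity p s :=
    setIntegral_nonneg measurableSet_Ioi fun s hs => mul_nonneg (le_of_lt hs) (heatDensity_nonneg p s)
  refine ⟨(heatMass p)⁻¹ * ∫ s in Ioi 0, s * heatDensity p s, by positivity, fun x hx => ?_⟩
  rw [one_sub_heatPrimitive hp, mul_assoc]
  refine mul_le_mul_of_nonneg_left ?_ (inv_nonneg.2 hm.le)
  rw [← div_eq_mul_inv, le_div_iff₀ hx, mul_comm, ← integral_const_mul]
  calc ∫ s in Ioi x, x * heatDensity p s ≤ ∫ s in Ioi x, s * heatDensity p s := by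
        refine setIntegral_mono_on ((integrable_heatDensity hp).integrableOn.const_mul x)
          (hi.mono_set (Ioi_subset_Ioi hx.le)) measurableSet_Ioi fun s hs => ?_
        exact mul_le_mul_of_nonneg_right (le_of_lt hs) (heatDensity_nonneg p s)
    _ ≤ _ := by
        refine setIntegral_mono_set hi ?_ (Ioi_subset_Ioi hx.le).eventuallyLE
        filter_upwards [ae_restrict_mem measurableSet_Ioi] with s hs
        exact mul_nonneg (le_of_lt hs) (heatDensity_nonneg p s)

/-- The measure `dt/t` is scale invariant: the substitution `s = t * lam` moves `lam` into the
endpoints. At `lam = 0` both sides vanish since `0^p = 0`. -/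
theorem integral_heatProfile_sq {p ε N lam : ℝ} (hp : 0 < p) (hε : 0 < ε) (hN : ε ≤ N)
    (hlam : 0 ≤ lam) : (heatMass p)⁻¹ * ∫ t in ε..N, t⁻¹ * (heatProfile p (t * lam)) ^ 2 =
      heatPrimitive p (N * lam) - heatPrimitive p (ε * lam) := by
  rcases hlam.eq_or_lt with rfl | h
  · simp [heatProfile, Real.zero_rpow hp.ne']
  have e : ∫ t in ε..N, t⁻¹ * (heatProfile p (t * lam)) ^ 2 =
      ∫ t in ε..N, lam * heatDensity p (t * lam) := by
    refine intervalIntegral.integral_congr fun t ht => ?_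
    rw [uIcc_of_le hN] at ht
    have ht0 : 0 < t := hε.trans_le ht.1
    have h0 : 0 < t * lam := mul_pos ht0 h
    rw [heatDensity_of_pos p h0, heatProfile, Real.rpow_sub_one h0.ne', mul_pow, ← Real.exp_nat_mul,
      ← Real.rpow_mul_natCast h0.le]
    push_cast
    rw [mul_comm p 2, show (2 : ℝ) * -(t * lam) = -(2 * (t * lam)) by ring]
    field_simp
  rw [e, intervalIntegral.integral_const_mul, intervalIntegral.integral_comp_mul_right _ h.ne',
    smul_eq_mul, mul_inv_cancel_left₀ h.ne', heatPrimitive, heatPrimitive, ← mul_sub,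
    intervalIntegral.integral_interval_sub_left] <;>
  exact (integrable_heatDensity hp).intervalIntegrable

/-! ### Strong convergence -/

section

variable {H : Type*} [NormedAddCommGroup H] [InnerProductSpace ℂ H] [CompleteSpace H]

/-- An injective self-adjoint operator has dense range, and a uniformly bounded family that tends to
0 on a dense set tends to 0 strongly. This replaces dominated convergence against spectral measures.
-/
theorem tendsto_zero_of_tendsto_comp {ι : Type*} {l : Filter ι} {A : ι → H →L[ℂ] H} {K : H →L[ℂ] H}
    (hK : IsSelfAdjoint K) (hinj : ∀ x, K x = 0 → x = 0) (hA : ∀ᶠ i in l, ‖A i‖ ≤ 1)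
    {b : ι → ℝ} (hb : Tendsto b l (𝓝 0)) (hAK : ∀ᶠ i in l, ∀ x, ‖A i (K x)‖ ≤ b i * ‖x‖) (f : H) :
    Tendsto (fun i => A i f) l (𝓝 0) := by
  have hd : DenseRange K := by
    have h1 : K.rangeᗮ = ⊥ := by
      rw [ContinuousLinearMap.orthogonal_range, hK.adjoint_eq]
      exact LinearMap.ker_eq_bot'.2 hinj
    have h2 := Submodule.topologicalClosure_eq_top_iff.2 h1
    exact Submodule.dense_iff_topologicalClosure_eq_top.2 h2
  rw [Metric.tendsto_nhds]
  intro ε hε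
  obtain ⟨x, hx⟩ := hd.exists_dist_lt f (half_pos hε)
  have h3 : ∀ᶠ i in l, b i * ‖x‖ < ε / 2 := by
    have := hb.mul_const ‖x‖
    rw [zero_mul] at this
    exact this.eventually_lt_const (half_pos hε)
  filter_upwards [hA, hAK, h3] with i h1 h2 h3
  rw [dist_zero_right]
  calc ‖A i f‖ = ‖A i (f - K x) + A i (K x)‖ := by rw [map_sub, sub_add_cancel]
    _ ≤ ‖A i (f - K x)‖ + ‖A i (K x)‖ := norm_add_le _ _
    _ ≤ 1 * ‖f - K x‖ + b i * ‖x‖ := add_le_add ((A i).le_of_opNorm_le h1 _) (h2 x)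
    _ < ε / 2 + ε / 2 := by
        rw [one_mul, ← dist_eq_norm]
        exact add_lt_add hx h3
    _ = ε := add_halves ε

namespace IsResolvent

variable {R : H →L[ℂ] H} (hR : IsResolvent R) {α p : ℝ} (hα : 0 < α) (hp : 0 < p)

/-- The bounded operator `heatPrimitive p (t B ^ α)`, where `R = (1 + B)⁻¹`. -/
noncomputable def heatPrimitiveOp (R : H →L[ℂ] H) (α p t : ℝ) : H →L[ℂ] H :=
  cfc (spectralLift (heatPrimitive p) 1 α t) R

include hα hp in
omit [NormedAddCommGroup H] [InnerProductSpace ℂ H] [CompleteSpace H] in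
theorem continuousOn_lift_heatPrimitive {t : ℝ} (ht : 0 < t) :
    ContinuousOn (spectralLift (heatPrimitive p) 1 α t) (Icc 0 1) :=
  continuousOn_spectralLift_right hα ht (continuous_heatPrimitive hp).continuousOn
    (tendsto_heatPrimitive hp)

theorem spectralLift_heatPrimitive_mem {p α t r : ℝ} (hp : 0 < p) (ht : 0 < t)
    (hr : r ∈ Icc (0 : ℝ) 1) : spectralLift (heatPrimitive p) 1 α t r ∈ Icc (0 : ℝ) 1 := by
  rcases hr.1.eq_or_lt with rfl | h
  · simp [spectralLift_zero]
  · rw [spectralLift_of_pos _ _ _ _ h]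
    exact ⟨heatPrimitive_nonneg hp (mul_nonneg ht.le
      (Real.rpow_nonneg (inv_sub_one_nonneg h hr.2) _)), heatPrimitive_le_one hp _⟩

include hR hα hp

theorem tendsto_heatPrimitiveOp_zero (f : H) :
    Tendsto (fun t => heatPrimitiveOp R α p t f) (𝓝[>] 0) (𝓝 0) := by
  have hβ : 0 < 2 * (α * p) := by positivity
  obtain ⟨C, hC, hle⟩ := exists_heatPrimitive_le hp
  have hb : Tendsto (fun t : ℝ => C * t ^ (2 * p)) (𝓝[>] 0) (𝓝 0) := by
    have h := (Real.continuous_rpow_const (q := 2 * p) (by positivity)).tendsto 0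
    rw [Real.zero_rpow (by positivity)] at h
    simpa using (h.mono_left nhdsWithin_le_nhds).const_mul C
  -- The bound `C (t s^α)^{2p}` grows like `s^{2αp}`; the factor `r^{2αp}` compensates, because `s r
  -- = 1 - r ≤ 1`.
  refine tendsto_zero_of_tendsto_comp (K := cfc (fun r : ℝ => r ^ (2 * (α * p))) R)
    (cfc_predicate _ _) (fun x => hR.cfc_rpow_left hβ) ?_ hb ?_ f
  · filter_upwards [self_mem_nhdsWithin] with t ht
    refine hR.norm_cfc_le zero_le_one fun r hr => ?_
    have := spectralLift_heatPrimitive_mem (α := α) hp ht hr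
    exact abs_le.2 ⟨by linarith [this.1], this.2⟩
  · filter_upwards [self_mem_nhdsWithin] with t (ht : 0 < t)
    intro x
    rw [heatPrimitiveOp, ← hR.cfc_mul_apply (continuousOn_lift_heatPrimitive hα hp ht)
      (continuousOn_rpow_left hβ)]
    refine ContinuousLinearMap.le_of_opNorm_le _ (hR.norm_cfc_le (by positivity) fun r hr => ?_) x
    have h1 := spectralLift_heatPrimitive_mem (α := α) hp ht hr
    have h2 := Real.rpow_nonneg hr.1 (2 * (α * p))
    rw [abs_of_nonneg (mul_nonneg h1.1 h2)]
    rcases hr.1.eq_or_lt with rfl | h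
    · rw [Real.zero_rpow hβ.ne', mul_zero]
      positivity
    · rw [spectralLift_of_pos _ _ _ _ h]
      have hs := inv_sub_one_nonneg h hr.2
      have h3 := hle (t * (r⁻¹ - 1) ^ α) (by positivity)
      have h4 : (r⁻¹ - 1) ^ (2 * (α * p)) * r ^ (2 * (α * p)) ≤ 1 := by
        rw [← Real.mul_rpow hs h.le]
        refine Real.rpow_le_one (by positivity) ?_ hβ.le
        rw [sub_mul, inv_mul_cancel₀ h.ne']
        linarith
      calc heatPrimitive p (t * (r⁻¹ - 1) ^ α) * r ^ (2 * (α * p))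
          ≤ C * (t * (r⁻¹ - 1) ^ α) ^ (2 * p) * r ^ (2 * (α * p)) :=
            mul_le_mul_of_nonneg_right h3 h2
        _ = C * t ^ (2 * p) * ((r⁻¹ - 1) ^ (2 * (α * p)) * r ^ (2 * (α * p))) := by
            rw [Real.mul_rpow ht.le (by positivity), ← Real.rpow_mul hs,
              show α * (2 * p) = 2 * (α * p) by ring]
            ring
        _ ≤ C * t ^ (2 * p) := mul_le_of_le_one_right (by positivity) h4

theorem tendsto_heatPrimitiveOp_atTop (f : H) :
    Tendsto (fun t => heatPrimitiveOp R α p t f) atTop (𝓝 f) := by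
  obtain ⟨C, hC, hle⟩ := exists_one_sub_heatPrimitive_le hp
  have hb : Tendsto (fun t : ℝ => C * t⁻¹) atTop (𝓝 0) := by
    simpa using tendsto_inv_atTop_zero.const_mul C
  have hcont : ∀ t, 0 < t →
      ContinuousOn (fun r => 1 - spectralLift (heatPrimitive p) 1 α t r) (Icc 0 1) :=
    fun t ht => continuousOn_const.sub (continuousOn_lift_heatPrimitive hα hp ht)
  have key : Tendsto (fun t => cfc (fun r => 1 - spectralLift (heatPrimitive p) 1 α t r) R f)
      atTop (𝓝 0) := by
    -- The bound `C / (t s^α)` blows up at `s = 0`; the factor `(1 - r)^α ≤ s^α` compensates. Its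
    -- injectivity is where `no_fixed`, that is `ker B = 0`, enters.
    refine tendsto_zero_of_tendsto_comp (K := cfc (fun r : ℝ => (1 - r) ^ α) R)
      (cfc_predicate _ _) (fun x => hR.cfc_rpow_right hα) ?_ hb ?_ f
    · filter_upwards [eventually_gt_atTop 0] with t ht
      refine hR.norm_cfc_le zero_le_one fun r hr => ?_
      have := spectralLift_heatPrimitive_mem (α := α) hp ht hr
      exact abs_le.2 ⟨by linarith [this.2], by linarith [this.1]⟩
    · filter_upwards [eventually_gt_atTop 0] with t ht
      intro x
      rw [← hR.cfc_mul_apply (hcont t ht) (continuousOn_rpow_right hα)]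
      refine ContinuousLinearMap.le_of_opNorm_le _ (hR.norm_cfc_le (by positivity) fun r hr => ?_) x
      have h1 := spectralLift_heatPrimitive_mem (α := α) hp ht hr
      have h2 := Real.rpow_nonneg (sub_nonneg.2 hr.2) α
      rw [abs_of_nonneg (mul_nonneg (sub_nonneg.2 h1.2) h2)]
      rcases hr.1.eq_or_lt with rfl | h
      · rw [spectralLift_zero, sub_self, zero_mul]
        positivity
      rcases hr.2.eq_or_lt with rfl | h'
      · rw [sub_self, Real.zero_rpow hα.ne', mul_zero]
        positivity
      rw [spectralLift_of_pos _ _ _ _ h]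
      have hs : 0 < r⁻¹ - 1 := sub_pos.2 ((one_lt_inv₀ h).2 h')
      have hsα := Real.rpow_pos_of_pos hs α
      have h3 := hle (t * (r⁻¹ - 1) ^ α) (by positivity)
      have h4 : (1 - r) ^ α ≤ (r⁻¹ - 1) ^ α := by
        refine Real.rpow_le_rpow (sub_nonneg.2 hr.2) ?_ hα.le
        rw [show r⁻¹ - 1 = (1 - r) / r by field_simp]
        exact le_div_self (sub_nonneg.2 hr.2) h hr.2
      calc (1 - heatPrimitive p (t * (r⁻¹ - 1) ^ α)) * (1 - r) ^ α
          ≤ C * (t * (r⁻¹ - 1) ^ α)⁻¹ * (r⁻¹ - 1) ^ α :=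
            mul_le_mul h3 h4 h2 (by positivity)
        _ = C * t⁻¹ := by field_simp
  have h := tendsto_const_nhds (x := f) (f := atTop (α := ℝ)) |>.sub key
  rw [sub_zero] at h
  refine h.congr' ?_
  filter_upwards [eventually_gt_atTop 0] with t ht
  rw [cfc_sub (fun _ => (1 : ℝ)) (spectralLift (heatPrimitive p) 1 α t) R continuousOn_const
    ((continuousOn_lift_heatPrimitive hα hp ht).mono hR.spectrum_subset),
    cfc_const_one ℝ R hR.isSelfAdjoint]
  simp [heatPrimitiveOp]

end IsResolvent

end

/-! ### The reproducing formula -/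

section

variable {H : Type*} [NormedAddCommGroup H] [InnerProductSpace ℂ H] [CompleteSpace H]

namespace IsResolvent

variable {R : H →L[ℂ] H} (hR : IsResolvent R) {α p : ℝ} (hα : 0 < α) (hp : 0 < p)

/-- The bounded operator `(t B ^ α) ^ p exp (-t B ^ α)`, where `R = (1 + B)⁻¹`. -/
noncomputable def heatOp (R : H →L[ℂ] H) (α p t : ℝ) : H →L[ℂ] H :=
  cfc (spectralLift (heatProfile p) 0 α t) R

theorem continuousOn_lift_heatProfile {α p : ℝ} (hα : 0 < α) (hp : 0 < p) :
    ContinuousOn (fun q : ℝ × ℝ => spectralLift (heatProfile p) 0 α q.1 q.2)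
      (Ioi 0 ×ˢ Icc 0 1) :=
  continuousOn_spectralLift hα (continuous_heatProfile hp).continuousOn (tendsto_heatProfile p)

include hα hp in
omit [NormedAddCommGroup H] [InnerProductSpace ℂ H] [CompleteSpace H] in
theorem continuousOn_lift_heatProfile_right {t : ℝ} (ht : 0 < t) :
    ContinuousOn (spectralLift (heatProfile p) 0 α t) (Icc 0 1) :=
  continuousOn_spectralLift_right hα ht (continuous_heatProfile hp).continuousOn
    (tendsto_heatProfile p)

include hR hα hp

theorem heatOp_heatOp {t : ℝ} (ht : 0 < t) (f : H) :
    heatOp R α p t (heatOp R α p t f) =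
      cfc (fun r => spectralLift (heatProfile p) 0 α t r ^ 2) R f := by
  have h := continuousOn_lift_heatProfile_right hα hp ht
  simp only [sq]
  rw [hR.cfc_mul_apply h h, heatOp]

/-- Joint continuity and compactness of the spectrum make the functions converge uniformly on the
spectrum as `t` varies, hence the operators converge in norm. -/
theorem continuousOn_cfc_heatProfile {g : ℝ → ℝ} (hg : Continuous g) :
    ContinuousOn (fun t => cfc (fun r => g (spectralLift (heatProfile p) 0 α t r)) R) (Ioi 0) := by
  intro t ht
  have hc : ContinuousOn (fun q : ℝ × ℝ => g (spectralLift (heatProfile p) 0 α q.1 q.2))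
      (Ioi 0 ×ˢ spectrum ℝ R) :=
    (hg.comp_continuousOn (continuousOn_lift_heatProfile hα hp)).mono
      (prod_mono_right hR.spectrum_subset)
  refine continuousWithinAt_cfc_fun ?_ ?_
  · intro u hu
    obtain ⟨v, hv, h⟩ := (ContinuousFunctionalCalculus.isCompact_spectrum
      (R := ℝ) R).mem_uniformity_of_prod
      (f := fun t r => g (spectralLift (heatProfile p) 0 α t r)) hc ht (symm_le_uniformity hu)
    filter_upwards [hv] with s hs r hr
    exact h s hs r hr
  · filter_upwards [self_mem_nhdsWithin] with s hs
    exact hg.comp_continuousOn ((continuousOn_lift_heatProfile_right hα hp hs).mono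
      hR.spectrum_subset)

theorem continuousOn_heatOp (f : H) : ContinuousOn (fun t => heatOp R α p t f) (Ioi 0) :=
  (hR.continuousOn_cfc_heatProfile hα hp continuous_id).clm_apply continuousOn_const

theorem continuousOn_integrand (f : H) :
    ContinuousOn (fun t : ℝ => t⁻¹ • heatOp R α p t (heatOp R α p t f)) (Ioi 0) := by
  refine (continuousOn_inv₀.mono fun t (ht : 0 < t) => ht.ne').smul ?_
  refine ContinuousOn.congr ((hR.continuousOn_cfc_heatProfile hα hp (continuous_pow 2)).clm_apply
    (continuousOn_const (c := f))) fun t ht => ?_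
  exact hR.heatOp_heatOp hα hp ht f

theorem intervalIntegrable_integrand (f : H) {ε N : ℝ} (hε : 0 < ε) (hN : 0 < N) :
    IntervalIntegrable (fun t : ℝ => t⁻¹ • heatOp R α p t (heatOp R α p t f)) volume ε N := by
  refine ((hR.continuousOn_integrand hα hp f).mono fun t ht => ?_).intervalIntegrable
  exact (lt_min hε hN).trans_le ht.1

/-- The integrand is bounded on `[ε, N] × spectrum`, so integration commutes with the functional
calculus; what remains is the scalar identity `integral_heatProfile_sq` at each `r`. -/
theorem integral_heatOp_sq (f : H) {ε N : ℝ} (hε : 0 < ε) (hN : ε ≤ N) :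
    (heatMass p)⁻¹ • ∫ t in ε..N, t⁻¹ • heatOp R α p t (heatOp R α p t f) =
      heatPrimitiveOp R α p N f - heatPrimitiveOp R α p ε f := by
  set F : ℝ → ℝ → ℝ := fun t r => t⁻¹ * spectralLift (heatProfile p) 0 α t r ^ 2 with hF
  have hpos : Ioc ε N ⊆ Ioi 0 := fun t ht => hε.trans ht.1
  have hc : ContinuousOn (Function.uncurry F) (Ioi 0 ×ˢ spectrum ℝ R) := by
    refine ContinuousOn.mul ?_ (((continuousOn_lift_heatProfile hα hp).mono
      (prod_mono_right hR.spectrum_subset)).pow 2)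
    exact continuousOn_fst.inv₀ fun q hq => (ne_of_gt hq.1 : q.1 ≠ 0)
  obtain ⟨C, hC⟩ := (isCompact_Icc.prod
    (ContinuousFunctionalCalculus.isCompact_spectrum (R := ℝ) R)).exists_bound_of_continuousOn
    (hc.mono (prod_mono_left fun t (ht : t ∈ Icc ε N) => hε.trans_le ht.1))
  have hbound : ∀ᵐ t ∂(volume.restrict (Ioc ε N)), ∀ z ∈ spectrum ℝ R, ‖F t z‖ ≤ C := by
    filter_upwards [ae_restrict_mem measurableSet_Ioc] with t ht z hz
    exact hC (t, z) ⟨Ioc_subset_Icc_self ht, hz⟩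
  have hfin : HasFiniteIntegral (fun _ : ℝ => C) (volume.restrict (Ioc ε N)) :=
    (integrable_const C).hasFiniteIntegral
  have hc' := hc.mono (prod_mono_left hpos)
  have h1 := cfc_setIntegral measurableSet_Ioc F (fun _ => C) R hc' hbound hfin hR.isSelfAdjoint
  have h2 := integrableOn_cfc measurableSet_Ioc F (fun _ => C) R hc' hbound hfin hR.isSelfAdjoint
  have h3 : ∫ t in ε..N, t⁻¹ • heatOp R α p t (heatOp R α p t f) =
      cfc (fun r => ∫ t in Ioc ε N, F t r) R f := by
    rw [h1, ContinuousLinearMap.integral_apply h2, intervalIntegral.integral_of_le hN]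
    refine setIntegral_congr_fun measurableSet_Ioc fun t ht => ?_
    rw [hR.heatOp_heatOp hα hp (hpos ht), hF, ← _root_.smul_apply, ← cfc_smul _
      (fun r => spectralLift (heatProfile p) 0 α t r ^ 2) _
      (((continuousOn_lift_heatProfile_right hα hp (hpos ht)).pow 2).mono hR.spectrum_subset)]
    rfl
  have c1 := (continuousOn_lift_heatPrimitive hα hp hε).mono hR.spectrum_subset
  have c2 := (continuousOn_lift_heatPrimitive hα hp (hε.trans_le hN)).mono hR.spectrum_subset
  have h4 : ∀ r ∈ Icc (0 : ℝ) 1, (heatMass p)⁻¹ * ∫ t in Ioc ε N, F t r =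
      spectralLift (heatPrimitive p) 1 α N r - spectralLift (heatPrimitive p) 1 α ε r := by
    intro r hr
    rcases hr.1.eq_or_lt with rfl | h
    -- At `r = 0` the integrand is 0 and both primitives have the limiting value 1.
    · simp [hF, spectralLift_zero]
    · simp only [hF, spectralLift_of_pos _ _ _ _ h]
      rw [← intervalIntegral.integral_of_le hN]
      exact integral_heatProfile_sq hp hε hN (Real.rpow_nonneg (inv_sub_one_nonneg h hr.2) _)
  -- Continuity of the parameter integral is read off from its closed form.
  have c3 : ContinuousOn (fun r => ∫ t in Ioc ε N, F t r) (spectrum ℝ R) := by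
    refine ((c2.sub c1).const_smul (heatMass p)).congr fun r hr => ?_
    have := h4 r (hR.spectrum_subset hr)
    simp only [Pi.sub_apply, smul_eq_mul, Pi.smul_apply]
    rw [← this, mul_inv_cancel_left₀ (heatMass_pos hp).ne']
  rw [h3, ← _root_.smul_apply, ← cfc_smul _ _ _ c3, heatPrimitiveOp, heatPrimitiveOp,
    ← _root_.sub_apply, ← cfc_sub _ _ _ c2 c1]
  congr 1
  exact hR.cfc_congr h4

theorem reproducing_formula (f : H) :
    (∃ G : ℝ → H,
      (∀ N : ℝ, 0 < N → Tendsto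
        (fun ε : ℝ => ∫ t in ε..N, t⁻¹ • heatOp R α p t (heatOp R α p t f))
        (𝓝[>] 0) (𝓝 (G N))) ∧
      Tendsto (fun N : ℝ => (heatMass p)⁻¹ • G N) atTop (𝓝 f)) ∧
    Tendsto (fun q : ℝ × ℝ =>
        (heatMass p)⁻¹ • ∫ t in q.1..q.2, t⁻¹ • heatOp R α p t (heatOp R α p t f))
      (𝓝[>] 0 ×ˢ atTop) (𝓝 f) := by
  have hm := (heatMass_pos hp).ne'
  refine ⟨⟨fun N => heatMass p • heatPrimitiveOp R α p N f, fun N hN => ?_, ?_⟩, ?_⟩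
  · have h := ((tendsto_const_nhds (x := heatPrimitiveOp R α p N f)).sub
      (hR.tendsto_heatPrimitiveOp_zero hα hp f)).const_smul (heatMass p)
    rw [sub_zero] at h
    refine h.congr' ?_
    filter_upwards [Ioc_mem_nhdsGT hN] with ε hε
    rw [← hR.integral_heatOp_sq hα hp f hε.1 hε.2, smul_inv_smul₀ hm]
  · simpa only [inv_smul_smul₀ hm] using hR.tendsto_heatPrimitiveOp_atTop hα hp f
  · have h := ((hR.tendsto_heatPrimitiveOp_atTop hα hp f).comp tendsto_snd).sub
      ((hR.tendsto_heatPrimitiveOp_zero hα hp f).comp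
        (tendsto_fst (f := 𝓝[>] (0 : ℝ)) (g := atTop (α := ℝ))))
    rw [sub_zero] at h
    refine h.congr' ?_
    filter_upwards [prod_mem_prod (Ioc_mem_nhdsGT (one_pos : (0 : ℝ) < 1)) (Ici_mem_atTop 1)]
      with q hq
    exact (hR.integral_heatOp_sq hα hp f hq.1.1 (hq.1.2.trans hq.2)).symm

/-- The square function identity. -/
theorem integral_norm_heatOp_sq (f : H) :
    IntegrableOn (fun t : ℝ => t⁻¹ * ‖heatOp R α p t f‖ ^ 2) (Ioi 0) ∧
      (heatMass p)⁻¹ * ∫ t in Ioi 0, t⁻¹ * ‖heatOp R α p t f‖ ^ 2 = ‖f‖ ^ 2 := by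
  have hm := heatMass_pos hp
  have hcont : ContinuousOn (fun t : ℝ => t⁻¹ * ‖heatOp R α p t f‖ ^ 2) (Ioi 0) :=
    (continuousOn_inv₀.mono fun t (ht : 0 < t) => ht.ne').mul
      ((hR.continuousOn_heatOp hα hp f).norm.pow 2)
  have ha : Tendsto (fun k : ℕ => 1 / ((k : ℝ) + 1)) atTop (𝓝[>] 0) :=
    tendsto_nhdsWithin_iff.2 ⟨tendsto_one_div_add_atTop_nhds_zero_nat,
      Eventually.of_forall fun k => (by positivity : (0 : ℝ) < 1 / ((k : ℝ) + 1))⟩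
  have hb : Tendsto (fun k : ℕ => (k : ℝ) + 1) atTop atTop :=
    tendsto_atTop_add_const_right _ _ tendsto_natCast_atTop_atTop
  -- The intervals `(1/(k+1), k+1]` exhaust the half-line, so the joint limit in the reproducing
  -- formula, taken along them, computes the integral of a nonnegative function and yields its
  -- integrability.
  have hcover : AECover (volume.restrict (Ioi 0)) atTop
      (fun k : ℕ => Ioi (1 / ((k : ℝ) + 1)) ∩ Iic ((k : ℝ) + 1)) :=
    (aecover_Ioi_of_Ioi (tendsto_nhdsWithin_iff.1 ha).1).inter (aecover_Iic hb)
  have hsub : ∀ k : ℕ, Ioi (1 / ((k : ℝ) + 1)) ∩ Iic ((k : ℝ) + 1) ⊆ Ioi 0 := fun k t ht =>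
    lt_trans (by positivity : (0 : ℝ) < 1 / ((k : ℝ) + 1)) ht.1
  -- Self-adjointness of `heatOp` gives `‖D_t f‖² = ⟨f, D_t² f⟩`.
  have hinner : ∀ t : ℝ, 0 < t → t⁻¹ * ‖heatOp R α p t f‖ ^ 2 =
      (inner ℂ f (t⁻¹ • heatOp R α p t (heatOp R α p t f))).re := by
    intro t ht
    have hsa : IsSelfAdjoint (heatOp R α p t) := cfc_predicate _ _
    have : inner ℂ f (heatOp R α p t (heatOp R α p t f)) = ((‖heatOp R α p t f‖ ^ 2 : ℝ) : ℂ) := by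
      rw [← ContinuousLinearMap.adjoint_inner_left, hsa.adjoint_eq, inner_self_eq_norm_sq_to_K]
      push_cast
      rfl
    rw [← Complex.coe_smul, inner_smul_right, this, ← Complex.ofReal_mul, Complex.ofReal_re]
  have hint : ∀ k : ℕ, ∫ t in Ioi (1 / ((k : ℝ) + 1)) ∩ Iic ((k : ℝ) + 1),
      t⁻¹ * ‖heatOp R α p t f‖ ^ 2 ∂(volume.restrict (Ioi 0)) =
      (inner ℂ f (∫ t in (1 / ((k : ℝ) + 1))..((k : ℝ) + 1),
        t⁻¹ • heatOp R α p t (heatOp R α p t f))).re := by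
    intro k
    have h0 : 0 < 1 / ((k : ℝ) + 1) := by positivity
    have h1 : (0 : ℝ) < (k : ℝ) + 1 := by positivity
    have h01 : 1 / ((k : ℝ) + 1) ≤ (k : ℝ) + 1 := by
      rw [div_le_iff₀ h1]
      nlinarith [(Nat.cast_nonneg k : (0 : ℝ) ≤ k)]
    have hI := (intervalIntegrable_iff_integrableOn_Ioc_of_le h01).1
      (hR.intervalIntegrable_integrand hα hp f h0 h1)
    rw [Measure.restrict_restrict (measurableSet_Ioi.inter measurableSet_Iic),
      inter_eq_left.2 (hsub k), Ioi_inter_Iic, intervalIntegral.integral_of_le h01]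
    have e1 : inner ℂ f (∫ t in Ioc (1 / ((k : ℝ) + 1)) ((k : ℝ) + 1),
        t⁻¹ • heatOp R α p t (heatOp R α p t f)) =
        ∫ t in Ioc (1 / ((k : ℝ) + 1)) ((k : ℝ) + 1),
          inner ℂ f (t⁻¹ • heatOp R α p t (heatOp R α p t f)) :=
      ((innerSL ℂ f).integral_comp_comm hI).symm
    have e2 := (Complex.reCLM.integral_comp_comm ((innerSL ℂ f).integrable_comp hI))
    simp only [Complex.reCLM_apply, innerSL_apply_apply] at e2
    rw [e1, ← e2]
    refine setIntegral_congr_fun measurableSet_Ioc fun t ht => ?_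
    exact hinner t (h0.trans ht.1)
  have hlim : Tendsto (fun k : ℕ => ∫ t in Ioi (1 / ((k : ℝ) + 1)) ∩ Iic ((k : ℝ) + 1),
      t⁻¹ * ‖heatOp R α p t f‖ ^ 2 ∂(volume.restrict (Ioi 0))) atTop
      (𝓝 (heatMass p * ‖f‖ ^ 2)) := by
    have h := ((hR.reproducing_formula hα hp f).2.comp (ha.prodMk hb)).const_smul (heatMass p)
    have h' : Tendsto (fun x : H => (inner ℂ f x).re) (𝓝 (heatMass p • f))
        (𝓝 (inner ℂ f (heatMass p • f)).re) :=
      (Complex.continuous_re.comp (continuous_const.inner continuous_id)).tendsto _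
    have h2 := h'.comp h
    have e : (inner ℂ f (heatMass p • f)).re = heatMass p * ‖f‖ ^ 2 := by
      rw [← Complex.coe_smul, inner_smul_right, inner_self_eq_norm_sq_to_K]
      change (((heatMass p : ℝ) : ℂ) * (‖f‖ : ℂ) ^ 2).re = _
      rw [← Complex.ofReal_pow, ← Complex.ofReal_mul, Complex.ofReal_re]
    rw [e] at h2
    refine h2.congr fun k => ?_
    rw [hint]
    simp only [Function.comp_apply, smul_inv_smul₀ hm.ne']
  have hnn : 0 ≤ᵐ[volume.restrict (Ioi 0)] fun t : ℝ => t⁻¹ * ‖heatOp R α p t f‖ ^ 2 := by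
    filter_upwards [ae_restrict_mem measurableSet_Ioi] with t (ht : 0 < t)
    simp only [Pi.zero_apply]
    positivity
  have hloc : ∀ k : ℕ, IntegrableOn (fun t : ℝ => t⁻¹ * ‖heatOp R α p t f‖ ^ 2)
      (Ioi (1 / ((k : ℝ) + 1)) ∩ Iic ((k : ℝ) + 1)) (volume.restrict (Ioi 0)) := by
    intro k
    rw [IntegrableOn, Measure.restrict_restrict (measurableSet_Ioi.inter measurableSet_Iic),
      inter_eq_left.2 (hsub k), Ioi_inter_Iic]
    refine ((hcont.mono fun t ht => ?_).integrableOn_Icc).mono_set Ioc_subset_Icc_self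
    exact lt_of_lt_of_le (by positivity) ht.1
  refine ⟨hcover.integrable_of_integral_tendsto_of_nonneg_ae _ hloc hnn hlim, ?_⟩
  rw [hcover.integral_eq_of_tendsto_of_nonneg_ae _ hnn hloc hlim, inv_mul_cancel_left₀ hm.ne']

end IsResolvent

end

/-! ### Square integrable functions with values in `L²` as functions on the product -/

section

variable {X T : Type*} [MeasurableSpace X] [MeasurableSpace T] {ν : Measure X} {μ : Measure T}

theorem Lp_two_enorm_sq {Y E : Type*} [MeasurableSpace Y] [NormedAddCommGroup E] {m : Measure Y}
    (f : Lp E 2 m) : ‖f‖ₑ ^ 2 = ∫⁻ y, ‖f y‖ₑ ^ 2 ∂m := by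
  have h := eLpNorm_nnreal_pow_eq_lintegral (f := f) (μ := m) (p := 2) two_ne_zero
  rw [Lp.enorm_def]
  simpa using h

theorem ae_ae_swap_of_ae_prod [SFinite ν] [SFinite μ] {P : X × T → Prop}
    (h : ∀ᵐ z ∂(ν.prod μ), P z) : ∀ᵐ t ∂μ, ∀ᵐ x ∂ν, P (x, t) :=
  Measure.ae_ae_of_ae_prod (p := fun z : T × X => P z.swap)
    ((Measure.measurePreserving_swap (μ := μ) (ν := ν)).quasiMeasurePreserving.ae h)

/-- The function `g` of two variables represents the function `h` with values in `L²`. -/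
def Represents (h : Lp (Lp ℂ 2 ν) 2 μ) (g : Lp ℂ 2 (ν.prod μ)) : Prop :=
  ∀ᵐ t ∂μ, ∀ᵐ x ∂ν, g (x, t) = h t x

namespace Represents

variable [SFinite ν] [SFinite μ] {h h' : Lp (Lp ℂ 2 ν) 2 μ} {g g' : Lp ℂ 2 (ν.prod μ)}

theorem add (H : Represents h g) (H' : Represents h' g') : Represents (h + h') (g + g') := by
  filter_upwards [H, H', Lp.coeFn_add h h', ae_ae_swap_of_ae_prod (Lp.coeFn_add g g')]
    with t h1 h2 h3 h4
  rw [h3, Pi.add_apply]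
  filter_upwards [h1, h2, h4, Lp.coeFn_add (h t) (h' t)] with x h1 h2 h4 h5
  rw [h4, h5, Pi.add_apply, Pi.add_apply, h1, h2]

theorem smul (c : ℂ) (H : Represents h g) : Represents (c • h) (c • g) := by
  filter_upwards [H, Lp.coeFn_smul c h, ae_ae_swap_of_ae_prod (Lp.coeFn_smul c g)] with t h1 h3 h4
  rw [h3, Pi.smul_apply]
  filter_upwards [h1, h4, Lp.coeFn_smul c (h t)] with x h1 h4 h5
  rw [h4, h5, Pi.smul_apply, Pi.smul_apply, h1]

theorem sub (H : Represents h g) (H' : Represents h' g') : Represents (h - h') (g - g') := by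
  have := H.add (H'.smul (-1))
  simpa [sub_eq_add_neg] using this

/-- Tonelli's theorem. Together with linearity it makes the representing function unique and turns
Cauchy sequences of `h` into Cauchy sequences of `g`. -/
theorem norm_eq (H : Represents h g) : ‖g‖ = ‖h‖ := by
  have h1 : ‖g‖ₑ ^ 2 = ‖h‖ₑ ^ 2 := by
    rw [Lp_two_enorm_sq, Lp_two_enorm_sq, lintegral_prod_symm _
      ((Lp.aestronglyMeasurable g).enorm.pow_const 2)]
    refine lintegral_congr_ae ?_
    filter_upwards [H] with t ht
    rw [Lp_two_enorm_sq]
    refine lintegral_congr_ae ?_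
    filter_upwards [ht] with x hx
    rw [hx]
  have h2 : ‖g‖ ^ 2 = ‖h‖ ^ 2 := by
    have := congrArg ENNReal.toReal h1
    simpa using this
  exact (sq_eq_sq₀ (norm_nonneg _) (norm_nonneg _)).1 h2

theorem unique (H : Represents h g) (H' : Represents h g') : g = g' := by
  have := (H.sub H').norm_eq
  rwa [sub_self, norm_zero, norm_eq_zero, sub_eq_zero] at this

/-- Three nested subsequences are extracted: one along which `hs` converges in `L²(ν)` for a.e. `t`,
one along which `gs` converges a.e. on the product, and, for each such `t`, one along which the
slices converge a.e. in `x`. -/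
theorem of_tendsto {hs : ℕ → Lp (Lp ℂ 2 ν) 2 μ} {gs : ℕ → Lp ℂ 2 (ν.prod μ)}
    (H : ∀ k, Represents (hs k) (gs k)) (hh : Tendsto hs atTop (𝓝 h))
    (hg : Tendsto gs atTop (𝓝 g)) : Represents h g := by
  obtain ⟨φ, hφ, h1⟩ := (tendstoInMeasure_of_tendsto_Lp hh).exists_seq_tendsto_ae
  obtain ⟨ψ, hψ, h2⟩ := (tendstoInMeasure_of_tendsto_Lp
    (hg.comp hφ.tendsto_atTop)).exists_seq_tendsto_ae
  filter_upwards [h1, ae_ae_swap_of_ae_prod h2, ae_all_iff.2 H] with t h1 h2 h3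
  obtain ⟨χ, hχ, h4⟩ := (tendstoInMeasure_of_tendsto_Lp
    (h1.comp hψ.tendsto_atTop)).exists_seq_tendsto_ae
  filter_upwards [h2, ae_all_iff.2 h3, h4] with x h2 h3 h4
  refine tendsto_nhds_unique (h2.comp hχ.tendsto_atTop) (h4.congr fun k => ?_)
  exact (h3 _).symm

theorem exists_of_indicatorConst (c : Lp ℂ 2 ν) {s : Set T} (hs : MeasurableSet s) (hμ : μ s ≠ ⊤) :
    ∃ g, Represents (indicatorConstLp 2 hs hμ c) g := by
  have hi : MemLp (s.indicator fun _ => (1 : ℂ)) 2 μ := memLp_indicator_const 2 hs 1 (Or.inr hμ)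
  have hm : MemLp (fun z : X × T => c z.1 * s.indicator (fun _ => (1 : ℂ)) z.2) 2 (ν.prod μ) := by
    have hmeas : AEStronglyMeasurable (fun z : X × T => c z.1 * s.indicator (fun _ => (1 : ℂ)) z.2)
        (ν.prod μ) := (Lp.aestronglyMeasurable c).comp_fst.mul hi.aestronglyMeasurable.comp_snd
    refine (memLp_two_iff_integrable_sq_norm hmeas).2 ?_
    simp only [norm_mul, mul_pow]
    exact ((memLp_two_iff_integrable_sq_norm (Lp.aestronglyMeasurable c)).1 (Lp.memLp c)).mul_prod
      ((memLp_two_iff_integrable_sq_norm hi.aestronglyMeasurable).1 hi)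
  refine ⟨hm.toLp _, ?_⟩
  filter_upwards [ae_ae_swap_of_ae_prod hm.coeFn_toLp, indicatorConstLp_coeFn (p := 2) (hs := hs)
    (hμs := hμ) (c := c)] with t h1 h2
  rw [h2]
  by_cases ht : t ∈ s
  · filter_upwards [h1] with x h1
    rw [h1, indicator_of_mem ht, indicator_of_mem ht, mul_one]
  · filter_upwards [h1, Lp.coeFn_zero ℂ 2 ν] with x h1 h3
    rw [h1, indicator_of_notMem ht, indicator_of_notMem ht, mul_zero, h3, Pi.zero_apply]

/-- Simple functions are represented by products, and the isometry carries representability to their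
closure. This avoids choosing jointly measurable representatives of the slices. -/
theorem exists_represents (h : Lp (Lp ℂ 2 ν) 2 μ) : ∃ g, Represents h g := by
  refine Lp.induction (by simp) (motive := fun h : Lp (Lp ℂ 2 ν) 2 μ => ∃ g, Represents h g)
    ?_ ?_ ?_ h
  · intro c s hs hμ
    exact exists_of_indicatorConst c hs hμ.ne
  · rintro f f' hf hf' - ⟨g, hg⟩ ⟨g', hg'⟩
    exact ⟨g + g', hg.add hg'⟩
  · refine IsSeqClosed.isClosed fun hs h hmem hlim => ?_
    choose gs hgs using hmem
    have hc : CauchySeq gs := by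
      have h1 := hlim.cauchySeq
      rw [Metric.cauchySeq_iff] at h1 ⊢
      intro ε hε
      obtain ⟨N, hN⟩ := h1 ε hε
      refine ⟨N, fun m hm k hk => ?_⟩
      rw [dist_eq_norm, ((hgs m).sub (hgs k)).norm_eq, ← dist_eq_norm]
      exact hN m hm k hk
    obtain ⟨g, hg⟩ := cauchySeq_tendsto_of_complete hc
    exact ⟨g, of_tendsto hgs hlim hg⟩

end Represents

/-- The isometry of `L²(μ; L²(ν))` into `L²(ν × μ)`. -/
noncomputable def uncurryLp (ν : Measure X) (μ : Measure T) [SFinite ν] [SFinite μ] :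
    Lp (Lp ℂ 2 ν) 2 μ →ₗᵢ[ℂ] Lp ℂ 2 (ν.prod μ) where
  toFun h := (Represents.exists_represents h).choose
  map_add' h h' := (Represents.exists_represents (h + h')).choose_spec.unique
    ((Represents.exists_represents h).choose_spec.add
      (Represents.exists_represents h').choose_spec)
  map_smul' c h := (Represents.exists_represents (c • h)).choose_spec.unique
    ((Represents.exists_represents h).choose_spec.smul c)
  norm_map' h := (Represents.exists_represents h).choose_spec.norm_eq

theorem represents_uncurryLp [SFinite ν] [SFinite μ] (h : Lp (Lp ℂ 2 ν) 2 μ) :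
    Represents h (uncurryLp ν μ h) := (Represents.exists_represents h).choose_spec

end

/-! ### The square function isometry -/

/-- The measure `dt / t` on `(0, ∞)`. -/
noncomputable def multiplicativeMeasure : Measure ℝ :=
  ((volume : Measure ℝ).restrict (Ioi 0)).withDensity fun t => ENNReal.ofReal (1 / t)

instance : SFinite multiplicativeMeasure := by
  unfold multiplicativeMeasure
  infer_instance

/-- The density `1/t` is positive on the half-line, so statements valid a.e. for `dt/t` hold a.e.
for `dt`. -/
theorem restrict_absolutelyContinuous_multiplicativeMeasure :
    (volume : Measure ℝ).restrict (Ioi 0) ≪ multiplicativeMeasure := by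
  refine withDensity_absolutelyContinuous' (by fun_prop) ?_
  filter_upwards [ae_restrict_mem measurableSet_Ioi] with t (ht : 0 < t)
  exact (ENNReal.ofReal_pos.2 (one_div_pos.2 ht)).ne'

section

variable {H : Type*} [NormedAddCommGroup H] [InnerProductSpace ℂ H] [CompleteSpace H]

namespace IsResolvent

variable {R : H →L[ℂ] H} (hR : IsResolvent R) {α p : ℝ} (hα : 0 < α) (hp : 0 < p)
include hR hα hp

theorem lintegral_heatOp (f : H) :
    ∫⁻ t, ‖heatOp R α p t f‖ₑ ^ 2 ∂multiplicativeMeasure =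
      ENNReal.ofReal (heatMass p * ‖f‖ ^ 2) := by
  obtain ⟨h1, h2⟩ := hR.integral_norm_heatOp_sq hα hp f
  have hm := (hR.continuousOn_heatOp hα hp f).aestronglyMeasurable (μ := volume) measurableSet_Ioi
  rw [multiplicativeMeasure, lintegral_withDensity_eq_lintegral_mul₀ (by fun_prop)
    (hm.enorm.pow_const 2), ← h2, mul_inv_cancel_left₀ (heatMass_pos hp).ne',
    ofReal_integral_eq_lintegral_ofReal h1]
  · refine setLIntegral_congr_fun measurableSet_Ioi fun t (ht : 0 < t) => ?_
    simp only [Pi.mul_apply]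
    rw [ENNReal.ofReal_mul (inv_nonneg.2 ht.le), ENNReal.ofReal_pow (norm_nonneg _),
      ofReal_norm, one_div]
  · filter_upwards [ae_restrict_mem measurableSet_Ioi] with t (ht : 0 < t)
    simp only [Pi.zero_apply]
    positivity

theorem memLp_heatOp (f : H) :
    MemLp (fun t => heatOp R α p t f) 2 multiplicativeMeasure := by
  have hm := (hR.continuousOn_heatOp hα hp f).aestronglyMeasurable (μ := volume) measurableSet_Ioi
  refine ⟨hm.mono_ac (withDensity_absolutelyContinuous _ _), ?_⟩
  have h := eLpNorm_nnreal_pow_eq_lintegral (f := fun t => heatOp R α p t f)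
    (μ := multiplicativeMeasure) (p := 2) two_ne_zero
  have h' : eLpNorm (fun t => heatOp R α p t f) 2 multiplicativeMeasure ^ 2 =
      ENNReal.ofReal (heatMass p * ‖f‖ ^ 2) := by
    rw [← hR.lintegral_heatOp hα hp f]
    simpa using h
  refine (ENNReal.pow_lt_top_iff.1 (h' ▸ ENNReal.ofReal_lt_top)).resolve_right two_ne_zero

/-- The map `f ↦ √c D_t f`, with values in `L²(dt / t; H)`. -/
noncomputable def squareFunction : H →ₗᵢ[ℂ] Lp H 2 multiplicativeMeasure where
  toFun f := ((√(heatMass p)⁻¹ : ℝ) : ℂ) • (hR.memLp_heatOp hα hp f).toLp _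
  map_add' f g := by
    rw [← smul_add, ← MemLp.toLp_add]
    congr 2
    ext t
    simp
  map_smul' c f := by
    rw [RingHom.id_apply, smul_comm, ← MemLp.toLp_const_smul]
    congr 2
    ext t
    simp
  norm_map' f := by
    have hm := heatMass_pos hp
    have h := Lp_two_enorm_sq ((hR.memLp_heatOp hα hp f).toLp _)
    have h1 : ∫⁻ t, ‖(hR.memLp_heatOp hα hp f).toLp _ t‖ₑ ^ 2 ∂multiplicativeMeasure =
        ENNReal.ofReal (heatMass p * ‖f‖ ^ 2) := by
      rw [← hR.lintegral_heatOp hα hp f]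
      refine lintegral_congr_ae ?_
      filter_upwards [(hR.memLp_heatOp hα hp f).coeFn_toLp] with t ht
      rw [ht]
    rw [h1] at h
    have h2 : ‖(hR.memLp_heatOp hα hp f).toLp _‖ ^ 2 = heatMass p * ‖f‖ ^ 2 := by
      have := congrArg ENNReal.toReal h
      rw [ENNReal.toReal_ofReal (by positivity)] at this
      simpa using this
    change ‖((√(heatMass p)⁻¹ : ℝ) : ℂ) • (hR.memLp_heatOp hα hp f).toLp _‖ = ‖f‖
    rw [norm_smul, ← sq_eq_sq₀ (by positivity) (norm_nonneg _), mul_pow, h2, Complex.norm_real,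
      Real.norm_eq_abs, sq_abs, Real.sq_sqrt (by positivity), inv_mul_cancel_left₀ hm.ne']

theorem squareFunction_ae (f : H) : ∀ᵐ t ∂multiplicativeMeasure,
    hR.squareFunction hα hp f t = ((√(heatMass p)⁻¹ : ℝ) : ℂ) • heatOp R α p t f := by
  filter_upwards [Lp.coeFn_smul ((√(heatMass p)⁻¹ : ℝ) : ℂ) ((hR.memLp_heatOp hα hp f).toLp _),
    (hR.memLp_heatOp hα hp f).coeFn_toLp] with t h1 h2
  rw [← h2]
  exact h1

end IsResolvent

end

theorem exists_isometry_halfSpace {n : ℕ} {R : L2 n →L[ℂ] L2 n} (hR : IsResolvent R) {α p : ℝ}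
    (hα : 0 < α) (hp : 0 < p) :
    ∃ J : L2 n →ₗᵢ[ℂ] Lp ℂ 2 (halfSpaceMeasure n), ∀ f : L2 n,
      ∀ᵐ t ∂((volume : Measure ℝ).restrict (Ioi 0)), ∀ᵐ x ∂(volume : Measure (Rn n)),
        J f (x, t) = (√(heatMass p)⁻¹ : ℂ) * IsResolvent.heatOp R α p t f x := by
  refine ⟨(uncurryLp volume multiplicativeMeasure).comp (hR.squareFunction hα hp), fun f => ?_⟩
  refine restrict_absolutelyContinuous_multiplicativeMeasure.ae_le ?_
  filter_upwards [represents_uncurryLp (ν := (volume : Measure (Rn n)))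
    (hR.squareFunction hα hp f), hR.squareFunction_ae hα hp f] with t h1 h2
  rw [h2] at h1
  filter_upwards [h1, Lp.coeFn_smul ((√(heatMass p)⁻¹ : ℝ) : ℂ)
    (IsResolvent.heatOp R α p t f)] with x h1 h3
  exact h1.trans h3

/-! ### Test functions and weak derivatives -/

section

variable {n : ℕ}

theorem memLp_ofReal {φ : Rn n → ℝ} (h : Continuous φ) (hc : HasCompactSupport φ) :
    MemLp (fun x => (φ x : ℂ)) 2 (volume : Measure (Rn n)) :=
  (h.memLp_of_hasCompactSupport hc).ofReal

/-- The class in `L²` of a real continuous function with compact support. -/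
noncomputable def testLp {φ : Rn n → ℝ} (h : Continuous φ) (hc : HasCompactSupport φ) : L2 n :=
  (memLp_ofReal h hc).toLp _

theorem inner_testLp {φ : Rn n → ℝ} (h : Continuous φ) (hc : HasCompactSupport φ) (u : L2 n) :
    inner ℂ (testLp h hc) u = ∫ x, φ x • u x := by
  rw [L2.inner_def]
  refine integral_congr_ae ?_
  filter_upwards [(memLp_ofReal h hc).coeFn_toLp] with x hx
  rw [testLp, hx]
  simp [mul_comm]

/-- Each test function imposes an equation between inner products, which are continuous on `L²`. -/
theorem isClosed_hasWeakDeriv (i : Fin n) : IsClosed {p : L2 n × L2 n | HasWeakDeriv i p.1 p.2} := by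
  have e : {p : L2 n × L2 n | HasWeakDeriv i p.1 p.2} =
      ⋂ (φ : Rn n → ℝ) (hφ : ContDiff ℝ ∞ φ) (hc : HasCompactSupport φ),
        {p : L2 n × L2 n | inner ℂ (testLp (fderiv_single_continuous i hφ)
          (fderiv_single_compact i hc)) p.1 = - inner ℂ (testLp hφ.continuous hc) p.2} := by
    ext p
    simp only [mem_ofPred_eq, mem_iInter, inner_testLp]
    rfl
  rw [e]
  exact isClosed_iInter fun φ => isClosed_iInter fun hφ => isClosed_iInter fun hc =>
    isClosed_eq (continuous_const.inner continuous_fst) (continuous_const.inner continuous_snd).neg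

theorem hasWeakDeriv_testLp (i : Fin n) {φ : Rn n → ℝ} (hφ : ContDiff ℝ ∞ φ)
    (hc : HasCompactSupport φ) : HasWeakDeriv i (testLp hφ.continuous hc)
      (testLp (fderiv_single_continuous i hφ) (fderiv_single_compact i hc)) := by
  intro ψ hψ hψc
  have e : ∀ {f g : Rn n → ℝ} (hf : Continuous f) (hfc : HasCompactSupport f),
      ∫ x, g x • testLp hf hfc x = ((∫ x, g x * f x : ℝ) : ℂ) := by
    intro f g hf hfc
    rw [← integral_complex_ofReal]
    refine integral_congr_ae ?_
    filter_upwards [(memLp_ofReal hf hfc).coeFn_toLp] with x hx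
    rw [testLp, hx]
    simp
  rw [e, e, ← Complex.ofReal_neg]
  congr 1
  rw [integral_mul_fderiv_eq_neg_fderiv_mul_of_integrable, neg_neg]
  · exact ((fderiv_single_continuous i hψ).mul hφ.continuous).integrable_of_hasCompactSupport
      (fderiv_single_compact i hψc).mul_right
  · exact (hψ.continuous.mul (fderiv_single_continuous i hφ)).integrable_of_hasCompactSupport
      hψc.mul_right
  · exact (hψ.continuous.mul hφ.continuous).integrable_of_hasCompactSupport hψc.mul_right
  · exact fun x _ => (hψ.differentiable (by simp)).differentiableAt
  · exact fun x _ => (hφ.differentiable (by simp)).differentiableAt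

theorem eq_zero_of_forall_integral_test {u : L2 n}
    (h : ∀ φ : Rn n → ℝ, ContDiff ℝ ∞ φ → HasCompactSupport φ → ∫ x, φ x • u x = 0) : u = 0 := by
  rw [Lp.eq_zero_iff_ae_eq_zero]
  exact ae_eq_zero_of_integral_contDiff_smul_eq_zero
    ((Lp.memLp u).locallyIntegrable (by norm_num)) h

/-- Since `q ≥ 1`, `V` is integrable on the compact support of `φ`, so `√V` is square integrable
there, and `φ` is bounded. -/
theorem memLp_sqrt_mul_test {V : Rn n → ℝ} {q : ℝ} (hq1 : 1 ≤ q) (hV : IsReverseHolder q V)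
    {φ : Rn n → ℝ} (hφ : Continuous φ) (hc : HasCompactSupport φ) :
    MemLp (fun x => ((√(V x) : ℝ) : ℂ) * testLp hφ hc x) 2 volume := by
  set K := tsupport φ with hK
  have hKm : MeasurableSet K := (isClosed_tsupport φ).measurableSet
  have hVK : MemLp V 1 (volume.restrict K) := by
    have : IsFiniteMeasure (volume.restrict K) :=
      isFiniteMeasure_restrict.2 hc.measure_lt_top.ne
    exact (hV.locallyLq K hc).mono_exponent (by simpa using hq1)
  have hs : MemLp (fun x => √(V x)) 2 (volume.restrict K) := by
    refine (memLp_two_iff_integrable_sq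
      (Real.continuous_sqrt.comp_aestronglyMeasurable hVK.1)).2 ?_
    simp only [Real.sq_sqrt (hV.nonneg _)]
    exact memLp_one_iff_integrable.1 hVK
  obtain ⟨C, hC⟩ := hc.exists_bound_of_continuous hφ
  have h1 : MemLp (fun x => √(V x) * φ x) 2 (volume.restrict K) := by
    refine hs.of_le_mul (c := C) (hs.1.mul hφ.aestronglyMeasurable) (ae_of_all _ fun x => ?_)
    rw [norm_mul, mul_comm]
    exact mul_le_mul_of_nonneg_right (hC x) (norm_nonneg _)
  have h2 : MemLp (fun x => √(V x) * φ x) 2 volume := by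
    rw [← memLp_indicator_iff_restrict hKm] at h1
    refine h1.ae_eq (ae_of_all _ fun x => ?_)
    by_cases hx : x ∈ K
    · rw [indicator_of_mem hx]
    · simp only [indicator_of_notMem hx, image_eq_zero_of_notMem_tsupport hx, mul_zero]
  refine (h2.ofReal (K := ℂ)).ae_eq ?_
  filter_upwards [(memLp_ofReal hφ hc).coeFn_toLp] with x hx
  rw [testLp, hx]
  simp

theorem inFormDomain_test {V : Rn n → ℝ} {q : ℝ} (hq1 : 1 ≤ q) (hV : IsReverseHolder q V)
    {φ : Rn n → ℝ} (hφ : ContDiff ℝ ∞ φ) (hc : HasCompactSupport φ) :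
    InFormDomain V (testLp hφ.continuous hc)
      (fun i => testLp (fderiv_single_continuous i hφ) (fderiv_single_compact i hc)) :=
  ⟨fun i => hasWeakDeriv_testLp i hφ hc, memLp_sqrt_mul_test hq1 hV hφ.continuous hc⟩

/-- The form domain is dense. -/
theorem eq_zero_of_forall_inner_formDomain {V : Rn n → ℝ} {q : ℝ} (hq1 : 1 ≤ q)
    (hV : IsReverseHolder q V) {f : L2 n}
    (h : ∀ (v : L2 n) (Dv : Fin n → L2 n), InFormDomain V v Dv → inner ℂ v f = 0) : f = 0 := by
  refine eq_zero_of_forall_integral_test fun φ hφ hc => ?_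
  rw [← inner_testLp hφ.continuous hc]
  exact h _ _ (inFormDomain_test hq1 hV hφ hc)

/-! ### Square integrable functions with vanishing weak derivative -/

theorem hasCompactSupport_comp_sub_left {φ : Rn n → ℝ} (hc : HasCompactSupport φ) (y : Rn n) :
    HasCompactSupport fun x => φ (y - x) :=
  hc.comp_homeomorph (Homeomorph.subLeft y)

theorem norm_testLp_comp_sub_left {φ : Rn n → ℝ} (hφ : Continuous φ) (hc : HasCompactSupport φ)
    (y : Rn n) : ‖testLp (hφ.comp (continuous_const.sub continuous_id) :
      Continuous fun x => φ (y - x)) (hasCompactSupport_comp_sub_left hc y)‖ = ‖testLp hφ hc‖ := by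
  rw [testLp, testLp, Lp.norm_toLp, Lp.norm_toLp]
  congr 1
  exact eLpNorm_comp_measurePreserving (f := fun x => y - x) (g := fun x => (φ x : ℂ))
    (memLp_ofReal hφ hc).1 (Measure.measurePreserving_sub_left volume y)

/-- The convolution `u * φ` is differentiable, and its derivative along the `i`-th axis at `y` is
the weak derivative of `u` tested against `x ↦ φ (y - x)`, hence zero. -/
theorem integral_translate_const {i : Fin n} {u : L2 n} (h : HasWeakDeriv i u 0) {φ : Rn n → ℝ}
    (hφ : ContDiff ℝ ∞ φ) (hc : HasCompactSupport φ) (s : ℝ) :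
    ∫ x, φ (s • EuclideanSpace.single i 1 - x) • u x = ∫ x, φ (-x) • u x := by
  set e : Rn n := EuclideanSpace.single i 1
  set L : ℂ →L[ℝ] ℝ →L[ℝ] ℂ := (ContinuousLinearMap.lsmul ℝ ℝ).flip
  set F : Rn n → ℂ := MeasureTheory.convolution (u : Rn n → ℂ) φ L volume with hF
  have hFx : ∀ y, F y = ∫ x, φ (y - x) • u x := fun y => rfl
  have hloc : LocallyIntegrable (u : Rn n → ℂ) volume :=
    (Lp.memLp u).locallyIntegrable (by norm_num)
  have hd : ∀ y, HasFDerivAt F _ y := fun y =>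
    hc.hasFDerivAt_convolution_right L hloc (hφ.of_le (by simp)) y
  have hd0 : ∀ y, (MeasureTheory.convolution (u : Rn n → ℂ) (fderiv ℝ φ)
      (L.precompR (Rn n)) volume) y e = 0 := by
    intro y
    rw [convolution_precompR_apply L hloc (hc.fderiv ℝ) (hφ.continuous_fderiv (by simp))]
    have hψ : ContDiff ℝ ∞ fun x => φ (y - x) := hφ.comp (contDiff_const.sub contDiff_id)
    have h1 := h (fun x => φ (y - x)) hψ (hasCompactSupport_comp_sub_left hc y)
    have h2 : ∫ x, φ (y - x) • (0 : L2 n) x = 0 := by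
      rw [← inner_testLp hψ.continuous (hasCompactSupport_comp_sub_left hc y), inner_zero_right]
    rw [h2, neg_zero] at h1
    have h3 : ∀ x, fderiv ℝ (fun x => φ (y - x)) x e = - fderiv ℝ φ (y - x) e := by
      intro x
      have := ((hφ.differentiable (by simp)).differentiableAt.hasFDerivAt (x := y - x)).comp x
        ((hasFDerivAt_const y x).sub (hasFDerivAt_id x))
      have h4 : fderiv ℝ (fun x => φ (y - x)) x = _ := this.fderiv
      rw [h4]
      simp
    simp only [h3, e] at h1
    have h5 : ∫ x, (-(fderiv ℝ φ (y - x) e)) • u x = - ∫ x, (fderiv ℝ φ (y - x) e) • u x := by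
      rw [← integral_neg]
      simp
    rw [h5, neg_eq_zero] at h1
    exact h1
  have hline : ∀ t : ℝ, HasDerivAt (fun t : ℝ => F (t • e)) 0 t := by
    intro t
    have h1 := (hd (t • e)).comp_hasDerivAt t ((hasDerivAt_id t).smul_const e)
    simp only [one_smul] at h1
    rwa [hd0] at h1
  have := is_const_of_deriv_eq_zero (fun t => (hline t).differentiableAt)
    (fun t => (hline t).deriv) s 0
  simpa [hFx] using this

/-- The convolution of `u` with a test function is constant along the `i`-th axis, while it must
decay there: far out, the translated test function misses a compactly supported approximation of
`u`. -/
theorem eq_zero_of_hasWeakDeriv_zero {i : Fin n} {u : L2 n} (h : HasWeakDeriv i u 0) : u = 0 := by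
  refine eq_zero_of_forall_integral_test fun φ' hφ' hc' => ?_
  obtain ⟨φ, hφ, hc, hφφ⟩ : ∃ φ : Rn n → ℝ, ContDiff ℝ ∞ φ ∧ HasCompactSupport φ ∧
      ∀ x, φ' x = φ (-x) :=
    ⟨fun x => φ' (-x), hφ'.comp contDiff_neg, hc'.comp_homeomorph (Homeomorph.neg _), by simp⟩
  simp only [hφφ]
  set e : Rn n := EuclideanSpace.single i 1 with he
  set c := ∫ x, φ (-x) • u x with hcdef
  have hne : ‖e‖ = 1 := by simp [he]
  have key : ∀ ε > 0, ‖c‖ ≤ ‖testLp hφ.continuous hc‖ * ε := by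
    intro ε hε
    obtain ⟨g, hgc, hgu, hg, hgm⟩ := (Lp.memLp u).exists_hasCompactSupport_eLpNorm_sub_le
      (by simp) (ENNReal.ofReal_pos.2 hε).ne'
    obtain ⟨r1, hr1⟩ := hgc.isBounded.subset_closedBall (0 : Rn n)
    obtain ⟨r2, hr2⟩ := hc.isBounded.subset_closedBall (0 : Rn n)
    -- A point in both supports would give `s = ‖s • e‖ ≤ r2 + r1`, so this translation makes them
    -- disjoint.
    set s := |r1| + |r2| + 1 with hs
    have hφs : Continuous fun x => φ (s • e - x) :=
      hφ.continuous.comp (continuous_const.sub continuous_id)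
    have hcs := hasCompactSupport_comp_sub_left hc (s • e)
    have h0 : ∀ x, φ (s • e - x) * g x = 0 := by
      intro x
      by_contra hx
      obtain ⟨hx1, hx2⟩ := mul_ne_zero_iff.1 hx
      have b1 := hr1 (subset_tsupport _ hx2)
      have b2 := hr2 (subset_tsupport _ (by simpa using hx1))
      rw [mem_closedBall_zero_iff] at b1 b2
      have b3 : ‖s • e‖ ≤ ‖s • e - x‖ + ‖x‖ := by
        simpa using norm_add_le (s • e - x) x
      rw [norm_smul, hne, mul_one, Real.norm_eq_abs] at b3
      linarith [le_abs_self s, le_abs_self r1, le_abs_self r2]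
    have h1 : c = inner ℂ (testLp hφs hcs) (u - hgm.toLp g) := by
      rw [inner_sub_right, inner_testLp, inner_testLp, hcdef,
        ← integral_translate_const h hφ hc s]
      rw [integral_eq_zero_of_ae (f := fun x => φ (s • e - x) • hgm.toLp g x), sub_zero]
      filter_upwards [hgm.coeFn_toLp] with x hx
      rw [hx, Pi.zero_apply, Complex.real_smul]
      exact h0 x
    rw [h1]
    refine (norm_inner_le_norm _ _).trans ?_
    rw [norm_testLp_comp_sub_left hφ.continuous hc]
    refine mul_le_mul_of_nonneg_left ?_ (norm_nonneg _)
    have h2 : u - hgm.toLp g = ((Lp.memLp u).sub hgm).toLp _ := by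
      rw [MemLp.toLp_sub (Lp.memLp u) hgm, Lp.toLp_coeFn]
    rw [h2, Lp.norm_toLp]
    exact ENNReal.toReal_le_of_le_ofReal hε.le hgu
  have hlim : Tendsto (fun ε : ℝ => ‖testLp hφ.continuous hc‖ * ε) (𝓝[>] 0) (𝓝 0) := by
    have := (continuous_const_mul ‖testLp hφ.continuous hc‖).tendsto (0 : ℝ)
    rw [mul_zero] at this
    exact this.mono_left nhdsWithin_le_nhds
  have := ge_of_tendsto hlim (by filter_upwards [self_mem_nhdsWithin] with ε hε using key ε hε)
  exact norm_le_zero_iff.1 this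

end

/-! ### The operator associated with the energy form -/

section

variable {n : ℕ}

/-- The Hilbert space containing the triples `(∇ u, u, V ^ (1 / 2) u)`. -/
abbrev FormSpace (n : ℕ) : Type := PiLp 2 (fun _ : Fin n ⊕ Bool => L2 n)

/-- The multiplier may be unbounded; along a subsequence both components converge a.e. and the
pointwise relation passes to the limit. -/
theorem isClosed_ae_eq_mul (m : Rn n → ℂ) :
    IsClosed {p : L2 n × L2 n | (p.2 : Rn n → ℂ) =ᵐ[volume] fun x => m x * p.1 x} := by
  refine IsSeqClosed.isClosed fun ps p hmem hlim => ?_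
  obtain ⟨φ, hφ, h1⟩ := (tendstoInMeasure_of_tendsto_Lp
    ((continuous_fst.tendsto p).comp hlim)).exists_seq_tendsto_ae
  obtain ⟨ψ, hψ, h2⟩ := (tendstoInMeasure_of_tendsto_Lp
    (((continuous_snd.tendsto p).comp hlim).comp hφ.tendsto_atTop)).exists_seq_tendsto_ae
  change (p.2 : Rn n → ℂ) =ᵐ[volume] fun x => m x * p.1 x
  filter_upwards [h1, h2, ae_all_iff.2 hmem] with x h1 h2 h3
  refine tendsto_nhds_unique h2 (((h1.comp hψ.tendsto_atTop).const_mul (m x)).congr fun k => ?_)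
  exact (h3 _).symm

/-- The form domain, as a space of triples `(∇ u, u, V ^ (1 / 2) u)`. -/
def formDomain (V : Rn n → ℝ) : Submodule ℂ (FormSpace n) where
  carrier := {w | (∀ i, HasWeakDeriv i (w (Sum.inr false)) (w (Sum.inl i))) ∧
    (w (Sum.inr true) : Rn n → ℂ) =ᵐ[volume] fun x => ((√(V x) : ℝ) : ℂ) * w (Sum.inr false) x}
  add_mem' := by
    rintro w w' ⟨h1, h2⟩ ⟨h1', h2'⟩
    refine ⟨fun i => (h1 i).add (h1' i), ?_⟩
    filter_upwards [h2, h2', Lp.coeFn_add (w (Sum.inr false)) (w' (Sum.inr false)),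
      Lp.coeFn_add (w (Sum.inr true)) (w' (Sum.inr true))] with x h1 h2 h3 h4
    rw [PiLp.add_apply, PiLp.add_apply, h3, h4, Pi.add_apply, Pi.add_apply, h1, h2, mul_add]
  zero_mem' := by
    refine ⟨fun i => (inFormDomain_zero V).1 i, ?_⟩
    filter_upwards [Lp.coeFn_zero ℂ 2 (volume : Measure (Rn n))] with x hx
    rw [PiLp.zero_apply, PiLp.zero_apply, hx, Pi.zero_apply, mul_zero]
  smul_mem' := by
    rintro c w ⟨h1, h2⟩
    refine ⟨fun i => (h1 i).smul c, ?_⟩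
    filter_upwards [h2, Lp.coeFn_smul c (w (Sum.inr false)),
      Lp.coeFn_smul c (w (Sum.inr true))] with x h1 h3 h4
    rw [PiLp.smul_apply, PiLp.smul_apply, h3, h4, Pi.smul_apply, Pi.smul_apply, h1, smul_eq_mul,
      smul_eq_mul]
    ring

theorem isClosed_formDomain (V : Rn n → ℝ) : IsClosed (formDomain V : Set (FormSpace n)) := by
  have e : (formDomain V : Set (FormSpace n)) =
      (⋂ i, {w | HasWeakDeriv i (w (Sum.inr false)) (w (Sum.inl i))}) ∩
        {w | (w (Sum.inr true) : Rn n → ℂ) =ᵐ[volume]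
          fun x => ((√(V x) : ℝ) : ℂ) * w (Sum.inr false) x} := by
    ext w
    simp only [mem_inter_iff, mem_iInter]
    rfl
  have hc : ∀ k, Continuous fun w : FormSpace n => w k := fun k => by fun_prop
  rw [e]
  refine (isClosed_iInter fun i => ?_).inter ?_
  · exact (isClosed_hasWeakDeriv i).preimage ((hc (Sum.inr false)).prodMk (hc (Sum.inl i)))
  · exact (isClosed_ae_eq_mul _).preimage ((hc (Sum.inr false)).prodMk (hc (Sum.inr true)))

instance (V : Rn n → ℝ) : CompleteSpace (formDomain V) :=
  (isClosed_formDomain V).completeSpace_coe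

theorem inFormDomain_of_mem {V : Rn n → ℝ} (w : formDomain V) :
    InFormDomain V ((w : FormSpace n) (Sum.inr false)) fun i => (w : FormSpace n) (Sum.inl i) :=
  ⟨w.2.1, (Lp.memLp _).ae_eq w.2.2⟩

theorem exists_mem_formDomain {V : Rn n → ℝ} {u : L2 n} {Du : Fin n → L2 n}
    (h : InFormDomain V u Du) : ∃ w : formDomain V, (w : FormSpace n) (Sum.inr false) = u ∧
      ∀ i, (w : FormSpace n) (Sum.inl i) = Du i := by
  let w : FormSpace n := WithLp.toLp 2 (Sum.elim Du fun b => if b then h.2.toLp _ else u)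
  have hw : w ∈ formDomain V := by
    refine ⟨fun i => h.1 i, ?_⟩
    exact h.2.coeFn_toLp
  exact ⟨⟨w, hw⟩, rfl, fun i => rfl⟩

variable {A : Rn n → Matrix (Fin n) (Fin n) ℝ} (hA : IsElliptic A) (V : Rn n → ℝ)

include hA in
theorem memLp_coeff (i j : Fin n) :
    MemLp (fun x => (A x i j : ℂ)) ⊤ (volume : Measure (Rn n)) := by
  obtain ⟨M, hM⟩ := hA.bounded
  exact memLp_top_of_bound (Complex.measurable_ofReal.comp (hA.measurable i j)).aestronglyMeasurable
    M (ae_of_all _ fun x => by simpa using hM x i j)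

/-- Multiplication by a coefficient, on `L²`. -/
noncomputable def coeffMul (i j : Fin n) : L2 n →L[ℂ] L2 n :=
  (ContinuousLinearMap.mul ℂ ℂ).holderL volume ⊤ 2 2 ((memLp_coeff hA i j).toLp _)

theorem coeffMul_apply (i j : Fin n) (u : L2 n) :
    coeffMul hA i j u =ᵐ[volume] fun x => (A x i j : ℂ) * u x := by
  have h := (ContinuousLinearMap.mul ℂ ℂ).coeFn_holder (r := 2) ((memLp_coeff hA i j).toLp _) u
  filter_upwards [h, (memLp_coeff hA i j).coeFn_toLp] with x h1 h2
  rw [← h2]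
  exact h1

/-- The components of a triple in the form domain. -/
noncomputable def formProj (k : Fin n ⊕ Bool) : formDomain V →L[ℂ] L2 n :=
  (PiLp.proj 2 (fun _ : Fin n ⊕ Bool => L2 n) k).comp (formDomain V).subtypeL

/-- The operator on the form domain which represents the energy form plus the inner product. -/
noncomputable def formOp : formDomain V →L[ℂ] formDomain V :=
  (∑ i, ∑ j, (formProj V (Sum.inl i)).adjoint.comp
    ((coeffMul hA i j).comp (formProj V (Sum.inl j)))) +
  ((formProj V (Sum.inr true)).adjoint.comp (formProj V (Sum.inr true)) +
    (formProj V (Sum.inr false)).adjoint.comp (formProj V (Sum.inr false)))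

theorem inner_formOp (w w' : formDomain V) : inner ℂ w' (formOp hA V w) =
    (∑ i, ∑ j, inner ℂ (formProj V (Sum.inl i) w') (coeffMul hA i j (formProj V (Sum.inl j) w))) +
    (inner ℂ (formProj V (Sum.inr true) w') (formProj V (Sum.inr true) w) +
      inner ℂ (formProj V (Sum.inr false) w') (formProj V (Sum.inr false) w)) := by
  simp only [formOp, _root_.add_apply, _root_.sum_apply, inner_add_right, inner_sum,
    ContinuousLinearMap.comp_apply, ContinuousLinearMap.adjoint_inner_right]

theorem sum_inner_coeffMul (Du Dv : Fin n → L2 n) :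
    ∑ i, ∑ j, inner ℂ (Dv i) (coeffMul hA i j (Du j)) =
      ∫ x, ∑ i, ∑ j, (A x i j : ℂ) * Du j x * conj (Dv i x) := by
  have e : ∀ i j, (fun x => inner ℂ (Dv i x) (coeffMul hA i j (Du j) x)) =ᵐ[volume]
      fun x => (A x i j : ℂ) * Du j x * conj (Dv i x) := by
    intro i j
    filter_upwards [coeffMul_apply hA i j (Du j)] with x hx
    rw [hx, RCLike.inner_apply]
  have hi : ∀ i j, Integrable fun x => (A x i j : ℂ) * Du j x * conj (Dv i x) := fun i j =>
    (L2.integrable_inner (𝕜 := ℂ) (Dv i) (coeffMul hA i j (Du j))).congr (e i j)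
  rw [integral_finsetSum _ fun i _ => integrable_finsetSum _ fun j _ => hi i j]
  refine Finset.sum_congr rfl fun i _ => ?_
  rw [integral_finsetSum _ fun j _ => hi i j]
  exact Finset.sum_congr rfl fun j _ => integral_congr_ae (e i j)

theorem inner_formOp_eq {V : Rn n → ℝ} (hV : ∀ x, 0 ≤ V x) (w w' : formDomain V) :
    inner ℂ w' (formOp hA V w) =
      energyForm A V (formProj V (Sum.inr false) w) (fun i => formProj V (Sum.inl i) w)
        (formProj V (Sum.inr false) w') (fun i => formProj V (Sum.inl i) w') +
      inner ℂ (formProj V (Sum.inr false) w') (formProj V (Sum.inr false) w) := by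
  rw [inner_formOp, sum_inner_coeffMul hA (fun i => formProj V (Sum.inl i) w)
    (fun i => formProj V (Sum.inl i) w'), energyForm, add_assoc, L2.inner_def]
  congr 2
  refine integral_congr_ae ?_
  have h1 : (formProj V (Sum.inr true) w : Rn n → ℂ) =ᵐ[volume] fun x =>
    ((√(V x) : ℝ) : ℂ) * formProj V (Sum.inr false) w x := w.2.2
  have h2 : (formProj V (Sum.inr true) w' : Rn n → ℂ) =ᵐ[volume] fun x =>
    ((√(V x) : ℝ) : ℂ) * formProj V (Sum.inr false) w' x := w'.2.2
  filter_upwards [h1, h2] with x h1 h2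
  have : ((√(V x) : ℝ) : ℂ) * ((√(V x) : ℝ) : ℂ) = (V x : ℂ) := by
    rw [← Complex.ofReal_mul, Real.mul_self_sqrt (hV x)]
  rw [h1, h2, RCLike.inner_apply, map_mul, Complex.conj_ofReal, ← this]
  ring

include hA in
-- By symmetry of `A x` the cross terms in the imaginary part cancel, leaving the quadratic form at
-- the real and at the imaginary part of `z`, where ellipticity applies.
theorem sum_coeff_eq (x : Rn n) (z : Fin n → ℂ) :
    ∑ i, ∑ j, (A x i j : ℂ) * z j * conj (z i) =
      ((∑ i, ∑ j, A x i j * (z i).re * (z j).re + ∑ i, ∑ j, A x i j * (z i).im * (z j).im : ℝ) :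
        ℂ) := by
  apply Complex.ext
  · rw [Complex.ofReal_re]
    simp only [Complex.re_sum, ← Finset.sum_add_distrib]
    refine Finset.sum_congr rfl fun i _ => Finset.sum_congr rfl fun j _ => ?_
    simp only [Complex.mul_re, Complex.mul_im, Complex.conj_re, Complex.conj_im, Complex.ofReal_re,
      Complex.ofReal_im]
    ring
  · rw [Complex.ofReal_im]
    simp only [Complex.im_sum]
    have e : ∀ i j, ((A x i j : ℂ) * z j * conj (z i)).im =
        A x i j * ((z j).im * (z i).re) - A x i j * ((z j).re * (z i).im) := by
      intro i j
      simp only [Complex.mul_re, Complex.mul_im, Complex.conj_re, Complex.conj_im,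
        Complex.ofReal_re, Complex.ofReal_im]
      ring
    simp only [e, Finset.sum_sub_distrib]
    rw [sub_eq_zero, Finset.sum_comm]
    refine Finset.sum_congr rfl fun i _ => Finset.sum_congr rfl fun j _ => ?_
    rw [hA.symm x j i]
    ring

include hA in
/-- The gradient part of the energy is real, and bounded below by the Dirichlet energy. -/
theorem exists_gradient_energy {lam : ℝ} (hlam : ∀ x ξ : Rn n,
    lam * ‖ξ‖ ^ 2 ≤ ∑ i, ∑ j, A x i j * ξ i * ξ j) (Du : Fin n → L2 n) :
    ∃ r : ℝ, ∫ x, ∑ i, ∑ j, (A x i j : ℂ) * Du j x * conj (Du i x) = (r : ℂ) ∧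
      lam * ∑ i, ‖Du i‖ ^ 2 ≤ r := by
  set Q : Rn n → ℝ := fun x => ∑ i, ∑ j, A x i j * (Du i x).re * (Du j x).re +
    ∑ i, ∑ j, A x i j * (Du i x).im * (Du j x).im with hQ
  have e : (fun x => ∑ i, ∑ j, (A x i j : ℂ) * Du j x * conj (Du i x)) =
      fun x => ((Q x : ℝ) : ℂ) := funext fun x => sum_coeff_eq hA x fun i => Du i x
  have hint := integrable_gradient hA Du Du
  rw [e] at hint ⊢
  refine ⟨∫ x, Q x, integral_complex_ofReal, ?_⟩
  have hQi : Integrable Q := by simpa using hint.re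
  have hsq : ∀ i, Integrable fun x => ‖Du i x‖ ^ 2 := fun i =>
    (memLp_two_iff_integrable_sq_norm (Lp.aestronglyMeasurable _)).1 (Lp.memLp (Du i))
  have hn : ∀ i, ‖Du i‖ ^ 2 = ∫ x, ‖Du i x‖ ^ 2 := by
    intro i
    have h := inner_self_eq_norm_sq_to_K (𝕜 := ℂ) (Du i)
    rw [L2.inner_def] at h
    have h2 : ∫ x, inner ℂ (Du i x) (Du i x) = ((∫ x, ‖Du i x‖ ^ 2 : ℝ) : ℂ) := by
      rw [← integral_complex_ofReal]
      refine integral_congr_ae (ae_of_all _ fun x => ?_)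
      simp only [inner_self_eq_norm_sq_to_K]
      push_cast
      rfl
    rw [h2] at h
    refine Complex.ofReal_injective ?_
    rw [Complex.ofReal_pow]
    exact h.symm
  simp only [hn]
  rw [← integral_finsetSum _ fun i _ => hsq i, ← integral_const_mul]
  refine integral_mono ((integrable_finsetSum _ fun i _ => hsq i).const_mul lam) hQi fun x => ?_
  have h1 := hlam x (WithLp.toLp 2 fun i => (Du i x).re)
  have h2 := hlam x (WithLp.toLp 2 fun i => (Du i x).im)
  rw [EuclideanSpace.norm_sq_eq] at h1 h2
  have h3 : ∑ i, ‖Du i x‖ ^ 2 = ∑ i, (Du i x).re ^ 2 + ∑ i, (Du i x).im ^ 2 := by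
    rw [← Finset.sum_add_distrib]
    refine Finset.sum_congr rfl fun i _ => ?_
    rw [← Complex.normSq_eq_norm_sq, Complex.normSq_apply]
    ring
  simp only [Real.norm_eq_abs, sq_abs] at h1 h2
  simp only [h3, mul_add, hQ]
  exact add_le_add h1 h2

end

/-! ### Coercivity, Lax–Milgram, and the resolvent of the form -/

section

variable {n : ℕ} {A : Rn n → Matrix (Fin n) (Fin n) ℝ} (hA : IsElliptic A)

theorem norm_sq_formDomain {V : Rn n → ℝ} (w : formDomain V) :
    ‖w‖ ^ 2 = ∑ i, ‖formProj V (Sum.inl i) w‖ ^ 2 +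
      (‖formProj V (Sum.inr true) w‖ ^ 2 + ‖formProj V (Sum.inr false) w‖ ^ 2) := by
  rw [Submodule.coe_norm, PiLp.norm_sq_eq_of_L2, Fintype.sum_sum_type, Fintype.sum_bool]
  rfl

/-- The diagonal of the form is real and bounded below. -/
theorem exists_inner_formOp_self : ∃ lam : ℝ, 0 < lam ∧ ∀ (V : Rn n → ℝ) (w : formDomain V),
    ∃ r : ℝ, inner ℂ w (formOp hA V w) = (r : ℂ) ∧ lam * ‖w‖ ^ 2 ≤ r ∧
      lam * ∑ i, ‖formProj V (Sum.inl i) w‖ ^ 2 + ‖formProj V (Sum.inr false) w‖ ^ 2 ≤ r := by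
  obtain ⟨lam, h0, h1, h⟩ := hA.elliptic
  refine ⟨lam, h0, fun V w => ?_⟩
  obtain ⟨r, hr, hle⟩ := exists_gradient_energy hA (fun x ξ => (h x ξ).1)
    fun i => formProj V (Sum.inl i) w
  refine ⟨r + (‖formProj V (Sum.inr true) w‖ ^ 2 + ‖formProj V (Sum.inr false) w‖ ^ 2), ?_, ?_, ?_⟩
  · rw [inner_formOp, sum_inner_coeffMul hA (fun i => formProj V (Sum.inl i) w)
      (fun i => formProj V (Sum.inl i) w), hr, inner_self_eq_norm_sq_to_K,
      inner_self_eq_norm_sq_to_K]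
    push_cast
    rfl
  · rw [norm_sq_formDomain, mul_add]
    -- The potential and mass terms have coefficient 1, which dominates `lam` because `lam ≤ 1`.
    refine add_le_add hle (mul_le_of_le_one_left (by positivity) h1)
  · have := sq_nonneg ‖formProj V (Sum.inr true) w‖
    linarith

/-- Lax–Milgram: coercivity on the form domain, which is complete as a closed subspace. -/
theorem isUnit_formOp (V : Rn n → ℝ) : IsUnit (formOp hA V) := by
  obtain ⟨lam, h0, h⟩ := exists_inner_formOp_self hA
  refine ContinuousLinearMap.isUnit_of_forall_le_norm_inner_map _ (c := ⟨lam, h0.le⟩) h0 fun w => ?_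
  obtain ⟨r, hr, hle, -⟩ := h V w
  rw [norm_inner_symm, hr, Complex.norm_real]
  exact (mul_comm _ _).trans_le (hle.trans (le_abs_self r))

/-- The solution `w` of the variational problem with right-hand side `f`. -/
noncomputable def formSolve (V : Rn n → ℝ) : L2 n →L[ℂ] formDomain V :=
  (Ring.inverse (formOp hA V)).comp (formProj V (Sum.inr false)).adjoint

theorem formOp_formSolve (V : Rn n → ℝ) (f : L2 n) :
    formOp hA V (formSolve hA V f) = (formProj V (Sum.inr false)).adjoint f := by
  have h := Ring.mul_inverse_cancel _ (isUnit_formOp hA V)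
  exact congrArg (fun S : formDomain V →L[ℂ] formDomain V =>
    S ((formProj V (Sum.inr false)).adjoint f)) h

theorem eq_formSolve {V : Rn n → ℝ} {f : L2 n} {w : formDomain V}
    (h : formOp hA V w = (formProj V (Sum.inr false)).adjoint f) : w = formSolve hA V f := by
  have h' := Ring.inverse_mul_cancel _ (isUnit_formOp hA V)
  have : Ring.inverse (formOp hA V) (formOp hA V w) = w :=
    congrArg (fun S : formDomain V →L[ℂ] formDomain V => S w) h'
  rw [h] at this
  exact this.symm

/-- The resolvent of the operator associated with the form. -/
noncomputable def formResolvent (V : Rn n → ℝ) : L2 n →L[ℂ] L2 n :=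
  (formProj V (Sum.inr false)).comp (formSolve hA V)

theorem formResolvent_apply (V : Rn n → ℝ) (f : L2 n) :
    formResolvent hA V f = formProj V (Sum.inr false) (formSolve hA V f) := rfl

theorem inner_formSolve (V : Rn n → ℝ) (f : L2 n) :
    inner ℂ (formSolve hA V f) (formOp hA V (formSolve hA V f)) =
      inner ℂ (formResolvent hA V f) f := by
  rw [formOp_formSolve, ContinuousLinearMap.adjoint_inner_right, formResolvent_apply]

theorem HasWeakDeriv.unique {i : Fin n} {u g g' : L2 n} (h : HasWeakDeriv i u g)
    (h' : HasWeakDeriv i u g') : g = g' := by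
  rw [← sub_eq_zero]
  refine eq_zero_of_forall_integral_test fun φ hφ hc => ?_
  rw [← inner_testLp hφ.continuous hc, inner_sub_right, inner_testLp, inner_testLp, sub_eq_zero]
  exact neg_injective ((h φ hφ hc).symm.trans (h' φ hφ hc))

variable {V : Rn n → ℝ} {q : ℝ} (hq1 : 1 ≤ q) (hV : IsReverseHolder q V)

/-- `a(u, v) = ⟨v, f - u⟩` for all `v` is the variational equation `a(u, v) + ⟨v, u⟩ = ⟨v, f⟩`,
which the triple given by `formSolve` solves uniquely. -/
theorem mem_schrodingerGraph_iff (hV0 : ∀ x, 0 ≤ V x) (f u : L2 n) :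
    (u, f - u) ∈ schrodingerGraph A hA V hV0 ↔ formResolvent hA V f = u := by
  constructor
  · rintro ⟨Du, hu, h⟩
    obtain ⟨w, hw, hwD⟩ := exists_mem_formDomain hu
    have hs : formOp hA V w = (formProj V (Sum.inr false)).adjoint f := by
      refine ext_inner_left ℂ fun w' => ?_
      have h1 := h _ _ (inFormDomain_of_mem w')
      rw [inner_formOp_eq hA hV0, ContinuousLinearMap.adjoint_inner_right]
      have e1 : formProj V (Sum.inr false) w = u := hw
      have e2 : (fun i => formProj V (Sum.inl i) w) = Du := funext hwD
      rw [e1, e2]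
      have h2 : energyForm A V u Du (formProj V (Sum.inr false) w')
          (fun i => formProj V (Sum.inl i) w') =
          inner ℂ (formProj V (Sum.inr false) w') (f - u) := h1
      rw [h2, inner_sub_right, sub_add_cancel]
    rw [formResolvent_apply, ← eq_formSolve hA hs]
    exact hw
  · rintro rfl
    refine ⟨_, inFormDomain_of_mem (formSolve hA V f), fun v Dv hv => ?_⟩
    obtain ⟨w', hw', hwD'⟩ := exists_mem_formDomain hv
    have h1 := inner_formOp_eq hA hV0 (formSolve hA V f) w'
    rw [formOp_formSolve, ContinuousLinearMap.adjoint_inner_right] at h1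
    have e1 : formProj V (Sum.inr false) w' = v := hw'
    have e2 : (fun i => formProj V (Sum.inl i) w') = Dv := funext hwD'
    rw [e1, e2] at h1
    rw [inner_sub_right, h1, formResolvent_apply, add_sub_cancel_right]
    rfl

include hq1 hV in
theorem resolventOne_schrodinger (hV0 : ∀ x, 0 ≤ V x) :
    resolventOne (schrodinger A hA V hV0) = formResolvent hA V := by
  refine resolventOne_eq fun f u => ?_
  rw [exists_add_apply_eq_iff, schrodinger, Submodule.toLinearPMap_graph_eq,
    mem_schrodingerGraph_iff]
  -- The relation is single valued: over `u = 0` the weak gradient vanishes, so `g` is orthogonal to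
  -- the dense form domain.
  rintro ⟨u, g⟩ ⟨Du, hu, h⟩ rfl
  have hD : Du = 0 := funext fun i => (hu.1 i).unique ((inFormDomain_zero V).1 i)
  subst hD
  refine eq_zero_of_forall_inner_formDomain hq1 hV fun v Dv hv => ?_
  rw [← h v Dv hv]
  have := energyForm_smul A V 0 0 v 0 Dv
  simpa using this

/-- Testing the variational equation with its own solution gives the form plus `‖R f‖²`, and the
form is nonnegative. Positivity of `R` and `‖R‖ ≤ 1`, hence spectrum in `[0, 1]`, both follow. -/
theorem inner_formResolvent (V : Rn n → ℝ) (f : L2 n) : ∃ r : ℝ,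
    inner ℂ (formResolvent hA V f) f = (r : ℂ) ∧ ‖formResolvent hA V f‖ ^ 2 ≤ r := by
  obtain ⟨lam, h0, h⟩ := exists_inner_formOp_self hA
  obtain ⟨r, hr, -, hle⟩ := h V (formSolve hA V f)
  refine ⟨r, by rw [← hr, inner_formSolve], le_trans ?_ hle⟩
  rw [formResolvent_apply]
  exact le_add_of_nonneg_left (by positivity)

theorem isPositive_formResolvent (V : Rn n → ℝ) : (formResolvent hA V).IsPositive := by
  rw [ContinuousLinearMap.isPositive_iff_complex]
  intro f
  obtain ⟨r, hr, hle⟩ := inner_formResolvent hA V f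
  rw [hr]
  exact ⟨by simp, by simpa using (sq_nonneg _).trans hle⟩

theorem norm_formResolvent_le (V : Rn n → ℝ) : ‖formResolvent hA V‖ ≤ 1 := by
  refine ContinuousLinearMap.opNorm_le_bound _ zero_le_one fun f => ?_
  obtain ⟨r, hr, hle⟩ := inner_formResolvent hA V f
  have h1 := norm_inner_le_norm (𝕜 := ℂ) (formResolvent hA V f) f
  rw [hr, Complex.norm_real] at h1
  have h2 : ‖formResolvent hA V f‖ * ‖formResolvent hA V f‖ ≤ ‖formResolvent hA V f‖ * ‖f‖ := by
    rw [← sq]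
    exact hle.trans ((le_abs_self r).trans h1)
  rw [one_mul]
  rcases (norm_nonneg (formResolvent hA V f)).eq_or_lt with h | h
  · rw [← h]
    exact norm_nonneg f
  · exact le_of_mul_le_mul_left h2 h

include hq1 hV in
theorem isResolvent_formResolvent (hn : 0 < n) : IsResolvent (formResolvent hA V) where
  isSelfAdjoint := (isPositive_formResolvent hA V).isSelfAdjoint
  spectrum_subset := by
    intro r hr
    refine ⟨spectrum_nonneg_of_nonneg
      ((ContinuousLinearMap.nonneg_iff_isPositive _).2 (isPositive_formResolvent hA V)) hr, ?_⟩
    have h1 := spectrum.norm_le_norm_mul_of_mem hr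
    have h2 : ‖(1 : L2 n →L[ℂ] L2 n)‖ ≤ 1 := ContinuousLinearMap.norm_id_le
    calc r ≤ ‖r‖ := le_abs_self r
      _ ≤ 1 * 1 := h1.trans (mul_le_mul (norm_formResolvent_le hA V) h2 (norm_nonneg _) zero_le_one)
      _ = 1 := one_mul 1
  injective := by
    intro f hf
    obtain ⟨lam, h0, h⟩ := exists_inner_formOp_self hA
    obtain ⟨r, hr, hle, -⟩ := h V (formSolve hA V f)
    -- If `R f = 0`, the solution has zero energy and vanishes by coercivity; then `f` is orthogonal
    -- to the form domain, which is dense.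
    rw [inner_formSolve, hf, inner_zero_left] at hr
    have hr0 : r = 0 := by exact_mod_cast hr.symm
    rw [hr0] at hle
    have hw : formSolve hA V f = 0 := by
      rw [← norm_eq_zero, ← sq_eq_zero_iff]
      exact le_antisymm (nonpos_of_mul_nonpos_right hle h0) (sq_nonneg _)
    have h1 := formOp_formSolve hA V f
    rw [hw, map_zero] at h1
    refine eq_zero_of_forall_inner_formDomain hq1 hV fun v Dv hv => ?_
    obtain ⟨w', hw', -⟩ := exists_mem_formDomain hv
    have h2 : inner ℂ w' ((formProj V (Sum.inr false)).adjoint f) = inner ℂ v f := by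
      rw [ContinuousLinearMap.adjoint_inner_right]
      exact congrArg (fun z => inner ℂ z f) hw'
    rw [← h2, ← h1, inner_zero_right]
  no_fixed := by
    intro f hf
    obtain ⟨lam, h0, h⟩ := exists_inner_formOp_self hA
    obtain ⟨r, hr, -, hle⟩ := h V (formSolve hA V f)
    -- If `R f = f`, the energy plus `‖f‖²` equals `‖f‖²`, so the gradient of `f` vanishes; a single
    -- direction, available as `0 < n`, then gives `f = 0`.
    rw [inner_formSolve, hf, inner_self_eq_norm_sq_to_K] at hr
    have hr' : ‖f‖ ^ 2 = r := by
      refine Complex.ofReal_injective ?_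
      rw [Complex.ofReal_pow]
      exact hr
    rw [← formResolvent_apply, hf, hr'] at hle
    have hs : ∑ i, ‖formProj V (Sum.inl i) (formSolve hA V f)‖ ^ 2 ≤ 0 :=
      nonpos_of_mul_nonpos_right (by linarith) h0
    have hi : formProj V (Sum.inl ⟨0, hn⟩) (formSolve hA V f) = 0 := by
      have h1 := Finset.single_le_sum
        (f := fun i => ‖formProj V (Sum.inl i) (formSolve hA V f)‖ ^ 2)
        (fun i _ => sq_nonneg _) (Finset.mem_univ (⟨0, hn⟩ : Fin n))
      rw [← norm_eq_zero, ← sq_eq_zero_iff]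
      exact le_antisymm (h1.trans hs) (sq_nonneg _)
    have hd : HasWeakDeriv ⟨0, hn⟩ (formResolvent hA V f)
        (formProj V (Sum.inl ⟨0, hn⟩) (formSolve hA V f)) := (formSolve hA V f).2.1 _
    rw [hf, hi] at hd
    exact eq_zero_of_hasWeakDeriv_zero hd

end

/-! ### The theorem for the Schrödinger operator -/

theorem mainTheorem12 (α β : ℝ) (hα0 : 0 < α) (hα1 : α < 1) (hβ : 0 < β) :
    ∃ c : ℝ, 0 < c ∧
      ∀ (n : ℕ) (_hn : 3 ≤ n) (A : Rn n → Matrix (Fin n) (Fin n) ℝ) (hA : IsElliptic A)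
        (_hA2 : HasHolderCoeff A) (V : Rn n → ℝ) (q : ℝ) (_hq : (n : ℝ) / 2 < q)
        (hV : IsReverseHolder q V) (_hV0 : ¬ V =ᵐ[volume] 0)
        (L : L2 n →ₗ.[ℂ] L2 n) (_hL : L = schrodinger A hA V hV.nonneg),
        -- `L ^ β exp (-t L ^ α)` is everywhere defined on `L²`
        (∀ t : ℝ, 0 < t → ∀ f : L2 n, expNeg (fracPow L α) t f ∈ (fracPow L β).domain) ∧
        -- the isometry, up to a constant, into `L²(dx dt / t)`
        (∃ J : L2 n →ₗᵢ[ℂ] Lp ℂ 2 (halfSpaceMeasure n), ∀ f : L2 n,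
          ∀ᵐ t ∂((volume : Measure ℝ).restrict (Ioi 0)), ∀ᵐ x ∂(volume : Measure (Rn n)),
            J f (x, t) = (√c : ℂ) * fracHeat L α β t f x) ∧
        -- the reproducing formula
        (∀ f : L2 n,
          (∀ ε N : ℝ, 0 < ε → ε ≤ N → IntervalIntegrable
            (fun t : ℝ => t⁻¹ • fracHeat L α β t (fracHeat L α β t f)) volume ε N) ∧
          (∃ G : ℝ → L2 n,
            (∀ N : ℝ, 0 < N → Tendsto
              (fun ε : ℝ => ∫ t in ε..N, t⁻¹ • fracHeat L α β t (fracHeat L α β t f))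
              (𝓝[>] 0) (𝓝 (G N))) ∧
            Tendsto (fun N : ℝ => c • G N) atTop (𝓝 f)) ∧
          Tendsto (fun p : ℝ × ℝ =>
              c • ∫ t in p.1..p.2, t⁻¹ • fracHeat L α β t (fracHeat L α β t f))
            (𝓝[>] 0 ×ˢ atTop) (𝓝 f)) := by
  have hp : 0 < β / α := div_pos hβ hα0
  refine ⟨(heatMass (β / α))⁻¹, inv_pos.2 (heatMass_pos hp), ?_⟩
  intro n hn A hA _ V q hq hV _ L hL
  have hq1 : 1 ≤ q := by
    have : (3 : ℝ) ≤ n := by exact_mod_cast hn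
    linarith
  have hres : resolventOne L = formResolvent hA V := by
    rw [hL, resolventOne_schrodinger hA hq1 hV]
  have hR : IsResolvent (resolventOne L) := by
    rw [hres]
    exact isResolvent_formResolvent hA hq1 hV (by omega)
  -- The identification with a function of the resolvent holds only for `t > 0`, so the integrals
  -- below are compared on intervals with positive endpoints.
  have hfrac : ∀ t : ℝ, 0 < t → ∀ f : L2 n, fracHeat L α β t f =
      IsResolvent.heatOp (resolventOne L) α (β / α) t f :=
    fun t ht f => fracHeat_eq hR hα0 hβ ht f
  have hint : ∀ (f : L2 n) (ε N : ℝ), 0 < ε → 0 < N →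
      ∫ t in ε..N, t⁻¹ • fracHeat L α β t (fracHeat L α β t f) =
      ∫ t in ε..N, t⁻¹ • IsResolvent.heatOp (resolventOne L) α (β / α) t
        (IsResolvent.heatOp (resolventOne L) α (β / α) t f) := by
    intro f ε N hε hN
    refine intervalIntegral.integral_congr fun t ht => ?_
    have ht0 : 0 < t := (lt_min hε hN).trans_le ht.1
    simp only [hfrac t ht0]
  refine ⟨fun t ht f => expNeg_mem_domain hR hα0 hβ ht f, ?_, fun f => ⟨?_, ?_, ?_⟩⟩
  · obtain ⟨J, hJ⟩ := exists_isometry_halfSpace hR hα0 hp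
    refine ⟨J, fun f => ?_⟩
    filter_upwards [hJ f, ae_restrict_mem measurableSet_Ioi] with t h1 ht
    rw [hfrac t ht]
    exact h1
  · intro ε N hε hN
    refine (hR.intervalIntegrable_integrand hα0 hp f hε (hε.trans_le hN)).congr ?_
    intro t ht
    rw [uIoc_of_le hN] at ht
    simp only [hfrac t (hε.trans ht.1)]
    rfl
  · obtain ⟨G, hG, hG'⟩ := (hR.reproducing_formula hα0 hp f).1
    refine ⟨G, fun N hN => (hG N hN).congr' ?_, hG'⟩
    filter_upwards [self_mem_nhdsWithin] with ε hε
    exact (hint f ε N hε hN).symm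
  · refine (hR.reproducing_formula hα0 hp f).2.congr' ?_
    filter_upwards [prod_mem_prod self_mem_nhdsWithin (Ioi_mem_atTop (0 : ℝ))] with p hp
    rw [hint f _ _ hp.1 hp.2]
    rfl
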